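/- **Setting.** Let $\mathcal S\subset\mathbb R^{d_{\mathcal S}}$ and $\mathcal A\subset\mathbb R^{d_{\mathcal A}}$ ($\mathcal A\ne\emptyset$) be compact, each contained in a ball of radius $R$; let $c:\mathcal S\times\mathcal A\to[0,1]$ be a cost, $\gamma\in[0,1)$ a discount factor, $\Xi$ a noise space and $F:\mathcal S\times\mathcal A\times\Xi\to\mathcal S$ a measurable transition function. Assume that $c$ and $F(\cdot,\cdot,\xi)$, for every $\xi\in\Xi$, are $L$-Lipschitz in $(s,a)$ for the Euclidean distance. For a probability law $Q$ on $\Xi$, a randomized history-dependent policy $\pi$ and $s\in\mathcal S$, let $S_0=s$, let $A_t$ be drawn from $\pi$ given the history up to stage $t$, and let $S_{t+1}=F(S_t,A_t,\xi_t)$ with $\xi_0,\xi_1,\dots$ i.i.d. with law $Q$. Let $\emptyset\ne\Theta\subset\mathbb R^{d_\Theta}$ lie in a ball of radius $R_\Theta$ and let $f_\theta:\mathbb R\to\mathbb R$ satisfy, for all $\theta,\theta'\in\Theta$ and $z,z'\in\mathbb R$, $|f_\theta(z)-f_\theta(z')|\le L_C|z-z'|$ (with $L_C>0$) and $|f_\theta(z)-f_{\theta'}(z)|\le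 L_\Theta\|\theta-\theta'\|$. The dimensions $d_{\mathcal S},d_{\mathcal A},d_\Theta$ are at least $1$. Define the risks $$\mathcal R^{\pi}_Q(s)=\inf_{\theta\in\Theta}\mathbb E\Big[f_\theta\Big(\sum_{t=0}^\infty\gamma^t c(S_t,A_t)\Big)\Big],\qquad \mathcal R^{\pi}_{T,Q}(s)=\inf_{\theta\in\Theta}\mathbb E\Big[f_\theta\Big(\sum_{t=0}^{T}\gamma^t c(S_t,A_t)\Big)\Big].$$ Let $P$ be the true noise law and $\hat P_n=\frac1n\sum_{i=1}^n\delta_{x_i}$ the empirical law of $n\ge1$ i.i.d. samples $x_1,\dots,x_n$ from $P$. **Theorem.** For every $\kappa>1$ there is a constant $C>0$, depending only on $\kappa$, such that the following holds for all data as above and all $\epsilon>0$, $\delta\in(0,1)$. Put $$\Lambda=\log\frac{\kappa L_C}{(1-\gamma)\epsilon},\qquad T=\Big\lceil\frac{\Lambda}{1-\gamma}\Big\rceil\quad(T=0\text{ if }\Lambda\le 0),$$ and write $a^+=\max\{1,a\}$. If $$n\ \ge\ C\,\frac{L_C^2\,d_{\mathcal S}\,d_{\mathcal A}\,d_\Theta\,\Lambda^5}{(1-\gamma)^5\epsilon^2}\,\log\Big(2+\frac{L_C^+L_\Theta^+L^+R^+R_\Theta^+\,\Lambda}{(1-\gamma)\,\epsilon\,\delta}\Big),$$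 then, with probability at least $1-\delta$ over the samples, $$\Big|\inf_{\pi}\mathcal R^\pi_{T,\hat P_n}(s)-\inf_\pi\mathcal R^\pi_P(s)\Big|\le\epsilon\qquad\text{for all } s\in\mathcal S .$$ -/

import Mathlib

open MeasureTheory ProbabilityTheory

universe u

noncomputable section

namespace RiskSOC

/-- An infinite-horizon discounted stochastic optimal control problem
`(S, A, c, F, γ)` with noise space `Ξ`. The law of the noise is kept as a separate argument in the
definitions below, since the same problem is considered under the true law and under an
empirical law. -/
structure SOC (dS dA : ℕ) (Ξ : Type u) [MeasurableSpace Ξ] where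
  /-- state space -/
  S : Set (EuclideanSpace ℝ (Fin dS))
  /-- action space -/
  A : Set (EuclideanSpace ℝ (Fin dA))
  isCompact_S : IsCompact S
  isCompact_A : IsCompact A
  nonempty_A : A.Nonempty
  /-- per-stage cost -/
  c : S → A → ℝ
  c_mem : ∀ s a, c s a ∈ Set.Icc (0 : ℝ) 1
  continuous_c : Continuous fun p : S × A => c p.1 p.2
  /-- transition function -/
  F : S → A → Ξ → S
  measurable_F : Measurable fun p : S × A × Ξ => F p.1 p.2.1 p.2.2
  /-- discount factor -/
  γ : ℝ
  γ_nonneg : 0 ≤ γ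
  γ_lt_one : γ < 1

variable {dS dA d : ℕ} {Ξ : Type u} [MeasurableSpace Ξ]

namespace SOC

/-- The cost and the transition function are `L`-Lipschitz in the state-action pair, for the
Euclidean distance on pairs, and the state and action spaces have radius at most `R`. -/
structure IsLipschitz (M : SOC dS dA Ξ) (L R : ℝ) : Prop where
  cost : ∀ (s s' : M.S) (a a' : M.A),
    |M.c s a - M.c s' a'| ≤ L * Real.sqrt (dist s s' ^ 2 + dist a a' ^ 2)
  transition : ∀ (s s' : M.S) (a a' : M.A) (ξ : Ξ),
    dist (M.F s a ξ) (M.F s' a' ξ) ≤ L * Real.sqrt (dist s s' ^ 2 + dist a a' ^ 2)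
  radius_S : ∃ x, M.S ⊆ Metric.closedBall x R
  radius_A : ∃ x, M.A ⊆ Metric.closedBall x R

/-- A randomized history-dependent policy: at stage `t` the action is drawn from a Markov kernel
evaluated at the initial state and the actions and noises of the stages before `t` (which determine
the states up to stage `t`). -/
structure Policy (M : SOC dS dA Ξ) where
  act : (t : ℕ) → Kernel (M.S × (Fin t → M.A × Ξ)) M.A
  markov : ∀ t, IsMarkovKernel (act t)

instance (M : SOC dS dA Ξ) (π : M.Policy) (t : ℕ) : IsMarkovKernel (π.act t) := π.markov t

/-- Initial state together with the actions and noises of stages `0, …, n`. -/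
def history (M : SOC dS dA Ξ) (s : M.S) (n : ℕ) (h : (i : Finset.Iic n) → M.A × Ξ) :
    M.S × (Fin (n + 1) → M.A × Ξ) :=
  (s, fun i => h ⟨i.1, Finset.mem_Iic.2 (Nat.lt_succ_iff.1 i.2)⟩)

lemma measurable_history (M : SOC dS dA Ξ) (s : M.S) (n : ℕ) : Measurable (M.history s n) :=
  measurable_const.prodMk (measurable_pi_lambda _ fun _ => measurable_pi_apply _)

/-- Given the actions and noises of stages `0, …, n`, the action of stage `n + 1` is drawn from
the policy and the noise of stage `n + 1` is drawn from `P`, independently. -/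
def stepKernel (M : SOC dS dA Ξ) (P : Measure Ξ) (π : M.Policy) (s : M.S) (n : ℕ) :
    Kernel ((i : Finset.Iic n) → M.A × Ξ) (M.A × Ξ) :=
  ((π.act (n + 1)).comap (M.history s n) (M.measurable_history s n)) ×ₖ Kernel.const _ P

instance (M : SOC dS dA Ξ) (P : Measure Ξ) [IsProbabilityMeasure P] (π : M.Policy) (s : M.S)
    (n : ℕ) : IsMarkovKernel (M.stepKernel P π s n) := by
  unfold stepKernel; infer_instance

/-- Law of the sequence `(A_t, ξ_t)_{t ≥ 0}` under the policy `π`, the noise law `P` and the initial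
state `s`. -/
def law (M : SOC dS dA Ξ) (P : Measure Ξ) [IsProbabilityMeasure P] (π : M.Policy) (s : M.S) :
    Measure (ℕ → M.A × Ξ) :=
  Kernel.trajMeasure (X := fun _ => M.A × Ξ) ((π.act 0 (s, Fin.elim0)).prod P)
    (M.stepKernel P π s)

/-- The states: `S_0 = s` and `S_{t+1} = F(S_t, A_t, ξ_t)`. -/
def state (M : SOC dS dA Ξ) (s : M.S) (ω : ℕ → M.A × Ξ) : ℕ → M.S
  | 0 => s
  | t + 1 => M.F (M.state s ω t) (ω t).1 (ω t).2

/-- Total discounted cost `∑_{t ≥ 0} γ^t c(S_t, A_t)`. -/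
def totalCost (M : SOC dS dA Ξ) (s : M.S) (ω : ℕ → M.A × Ξ) : ℝ :=
  ∑' t : ℕ, M.γ ^ t * M.c (M.state s ω t) (ω t).1

/-- Total cost `∑_{t=0}^T γ^t c(S_t, A_t)` of the `T`-stage truncation. -/
def truncatedCost (M : SOC dS dA Ξ) (T : ℕ) (s : M.S) (ω : ℕ → M.A × Ξ) : ℝ :=
  ∑ t ∈ Finset.range (T + 1), M.γ ^ t * M.c (M.state s ω t) (ω t).1

/-- The risk `inf_{θ ∈ Θ} E[f_θ(X)]` of the cost `X` under the policy `π`, the noise law `P` and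
the initial state `s`. -/
def risk (M : SOC dS dA Ξ) (Θ : Set (EuclideanSpace ℝ (Fin d)))
    (f : EuclideanSpace ℝ (Fin d) → ℝ → ℝ) (P : Measure Ξ) [IsProbabilityMeasure P]
    (X : M.S → (ℕ → M.A × Ξ) → ℝ) (π : M.Policy) (s : M.S) : ℝ :=
  ⨅ θ : Θ, ∫ ω, f θ (X s ω) ∂(M.law P π s)

/-- Optimal risk of the infinite-horizon problem under the noise law `P`. -/
def optRisk (M : SOC dS dA Ξ) (Θ : Set (EuclideanSpace ℝ (Fin d)))
    (f : EuclideanSpace ℝ (Fin d) → ℝ → ℝ) (P : Measure Ξ) [IsProbabilityMeasure P]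
    (s : M.S) : ℝ :=
  ⨅ π : M.Policy, M.risk Θ f P M.totalCost π s

/-- Optimal risk of the `T`-stage truncation under the noise law `P`. -/
def optRiskTrunc (M : SOC dS dA Ξ) (Θ : Set (EuclideanSpace ℝ (Fin d)))
    (f : EuclideanSpace ℝ (Fin d) → ℝ → ℝ) (P : Measure Ξ) [IsProbabilityMeasure P] (T : ℕ)
    (s : M.S) : ℝ :=
  ⨅ π : M.Policy, M.risk Θ f P (M.truncatedCost T) π s

end SOC

/-- The family `(f_θ)_{θ ∈ Θ}` is `(L_Θ, L_C)`-Lipschitz and `Θ` has radius at most `R_Θ`. -/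
structure IsLipschitzRisk (Θ : Set (EuclideanSpace ℝ (Fin d)))
    (f : EuclideanSpace ℝ (Fin d) → ℝ → ℝ) (LC LΘ RΘ : ℝ) : Prop where
  lipschitz_cost : ∀ θ ∈ Θ, ∀ z z' : ℝ, |f θ z - f θ z'| ≤ LC * |z - z'|
  lipschitz_param : ∀ θ ∈ Θ, ∀ θ' ∈ Θ, ∀ z : ℝ, |f θ z - f θ' z| ≤ LΘ * ‖θ - θ'‖
  radius : ∃ x, Θ ⊆ Metric.closedBall x RΘ

/-- Empirical distribution `(1/n) ∑_i δ_{x_i}` of a sample of size `n`. -/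
def empirical {n : ℕ} (x : Fin n → Ξ) : Measure Ξ :=
  (n : ENNReal)⁻¹ • ∑ i, Measure.dirac (x i)

instance {n : ℕ} [NeZero n] (x : Fin n → Ξ) : IsProbabilityMeasure (empirical x) := by
  refine ⟨?_⟩
  simp only [empirical, Measure.smul_apply, Measure.finsetSum_apply, measure_univ,
    Finset.sum_const, Finset.card_univ, Fintype.card_fin, nsmul_eq_mul, mul_one, smul_eq_mul]
  exact ENNReal.inv_mul_cancel (by exact_mod_cast NeZero.ne n) (ENNReal.natCast_ne_top n)

end RiskSOC

end

noncomputable section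

namespace RiskSOC

/-! The infima over policies and over θ commute, so for each fixed θ the truncated problem is a
control problem with terminal cost f_θ on the augmented state (s, z), where z is the cost
accumulated so far. Dynamic programming under the true law P gives value functions V_t
(`SOC.value`).

These V_t serve as test functions under any other law Q. If the expectations of V_{t+1}(F(s,a,ξ), z)
under Q and P differ by at most e, uniformly in (t,s,a,z), then V_t solves the Bellman equation of Q
up to e. Telescoping along an arbitrary policy bounds its cost from below
(`SOC.le_integral_of_step`), and telescoping along a near-greedy measurable feedback gives the
matching upper bound (`SOC.integral_feedback_le_of_step`, `exists_measurable_approx_argmin`). Hence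
the optimal truncated risk moves by at most (T+1)e (`SOC.integral_near_value`,
`SOC.abs_optRiskTrunc_sub_iInf_value_le`); truncation adds at most L_C γ^(T+1)/(1-γ).

Since V_t depends on P but not on the samples, Hoeffding's inequality applies directly at fixed
(t,θ,s,a,z). The values stay within L_C/(1-γ) of f_θ(z) and are Lipschitz in all arguments
(`SOC.isRegular_value`, `SOC.abs_value_sub_value_le`), so a union bound over a finite net makes the
deviation uniform (`SOC.measure_not_deviationLE_le`). The Lipschitz constant in the state grows
exponentially in T, but it enters only through the logarithm of the net size, which costs a factor
of order Λ/(1-γ).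

With e of order ε/(T+1), Hoeffding asks for n of order L_C²Λ²/((1-γ)⁴ε²) times that logarithm,
whence (1-γ)⁵. This produces only Λ³; the two further powers of Λ are paid for by Λ ≥ log κ. -/

lemma abs_ciInf_sub_ciInf_le {ι : Sort*} [Nonempty ι] {g g' : ι → ℝ} {K : ℝ}
    (hg : BddBelow (Set.range g)) (hg' : BddBelow (Set.range g'))
    (h : ∀ i, |g i - g' i| ≤ K) : |(⨅ i, g i) - ⨅ i, g' i| ≤ K := by
  have key : ∀ {g g' : ι → ℝ}, BddBelow (Set.range g) → (∀ i, |g i - g' i| ≤ K) →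
      (⨅ i, g i) - K ≤ ⨅ i, g' i := by
    intro g g' hg h
    refine le_ciInf fun i => ?_
    have h1 := ciInf_le hg i
    have h2 := (abs_le.1 (h i)).2
    linarith
  have h1 := key hg h
  have h2 := key hg' fun i => by rw [abs_sub_comm]; exact h i
  rw [abs_le]
  constructor <;> linarith

lemma bddBelow_range_of_abs_sub_le {ι : Sort*} {g : ι → ℝ} {K m : ℝ} (h : ∀ i, |g i - m| ≤ K) :
    BddBelow (Set.range g) :=
  ⟨m - K, by rintro _ ⟨i, rfl⟩; linarith [(abs_le.1 (h i)).1]⟩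

lemma integrable_of_abs_le {α : Type*} [MeasurableSpace α] {μ : Measure α} [IsFiniteMeasure μ]
    {g : α → ℝ} {K : ℝ} (hg : Measurable g) (h : ∀ x, |g x| ≤ K) : Integrable g μ :=
  Integrable.of_bound hg.aestronglyMeasurable K (Filter.Eventually.of_forall h)

lemma abs_integral_sub_le {α : Type*} [MeasurableSpace α] {μ : Measure α}
    [IsProbabilityMeasure μ] {g : α → ℝ} {K m : ℝ} (hg : Integrable g μ)
    (h : ∀ x, |g x - m| ≤ K) : |∫ x, g x ∂μ - m| ≤ K := by
  have h1 : ∫ x, g x ∂μ - m = ∫ x, (g x - m) ∂μ := by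
    rw [integral_sub hg (integrable_const m)]; simp
  rw [h1]
  have h2 := norm_integral_le_of_norm_le_const (μ := μ) (f := fun x => g x - m)
    (Filter.Eventually.of_forall h)
  simpa using h2

lemma abs_integral_sub_integral_le {α : Type*} [MeasurableSpace α] {μ : Measure α}
    [IsProbabilityMeasure μ] {g g' : α → ℝ} {K : ℝ} (hg : Integrable g μ)
    (hg' : Integrable g' μ) (h : ∀ x, |g x - g' x| ≤ K) :
    |∫ x, g x ∂μ - ∫ x, g' x ∂μ| ≤ K := by
  rw [← integral_sub hg hg']
  have h2 := norm_integral_le_of_norm_le_const (μ := μ) (f := fun x => g x - g' x)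
    (Filter.Eventually.of_forall h)
  simpa using h2

/-! ### Finite nets in finite-dimensional spaces. -/

open Metric Module in
open scoped Function in
/-- Volume bound for the size of a separated set. -/
lemma card_le_of_isSeparated {E : Type*} [NormedAddCommGroup E] [NormedSpace ℝ E]
    [FiniteDimensional ℝ E] {x : E} {R r : ℝ} (hR : 0 ≤ R) (hr : 0 < r) (s : Finset E)
    (hs : (s : Set E) ⊆ closedBall x R) (h : (s : Set E).Pairwise fun a b => r < dist a b) :
    (s.card : ℝ) ≤ (1 + 2 * R / r) ^ finrank ℝ E := by
  borelize E
  let μ : Measure E := Measure.addHaar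
  have hr2 : 0 < r / 2 := by positivity
  have hρ : 0 < R + r / 2 := by positivity
  have D : Set.Pairwise (s : Set E) (Disjoint on fun c => ball (c : E) (r / 2)) := by
    intro c hc d hd hcd
    apply ball_disjoint_ball
    have := h hc hd hcd
    linarith
  have hsub : (⋃ c ∈ s, ball (c : E) (r / 2)) ⊆ ball x (R + r / 2) := by
    refine Set.iUnion₂_subset fun c hc => ball_subset_ball' ?_
    have := mem_closedBall.1 (hs hc)
    linarith
  have I : (s.card : ENNReal) * ENNReal.ofReal ((r / 2) ^ finrank ℝ E) * μ (ball 0 1) ≤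
      ENNReal.ofReal ((R + r / 2) ^ finrank ℝ E) * μ (ball 0 1) :=
    calc
      _ = μ (⋃ c ∈ s, ball (c : E) (r / 2)) := by
        rw [measure_biUnion_finset D fun c _ => measurableSet_ball]
        simp only [μ.addHaar_ball_of_pos _ hr2]
        simp only [Finset.sum_const, nsmul_eq_mul, mul_assoc]
      _ ≤ μ (ball x (R + r / 2)) := measure_mono hsub
      _ = _ := by simp only [μ.addHaar_ball_of_pos _ hρ]
  have J := (ENNReal.mul_le_mul_iff_left (measure_ball_pos μ _ zero_lt_one).ne'
    measure_ball_lt_top.ne).1 I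
  have K := ENNReal.toReal_le_of_le_ofReal (by positivity) J
  rw [ENNReal.toReal_mul, ENNReal.toReal_natCast, ENNReal.toReal_ofReal (by positivity)] at K
  have e : 1 + 2 * R / r = (R + r / 2) / (r / 2) := by field_simp; ring
  rw [e, div_pow, le_div_iff₀ (by positivity)]
  exact K

open Metric Module in
-- A separated subset of maximal cardinality is a net. The centres are taken in A itself, so that
-- they are admissible states, actions or parameters.
lemma exists_net {E : Type*} [NormedAddCommGroup E] [NormedSpace ℝ E]
    [FiniteDimensional ℝ E] {A : Set E} {x : E} {R r : ℝ} (hR : 0 ≤ R) (hr : 0 < r)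
    (hA : A ⊆ closedBall x R) :
    ∃ N : Finset A, (∀ a : A, ∃ b ∈ N, dist a b ≤ r) ∧
      (N.card : ℝ) ≤ (1 + 2 * R / r) ^ finrank ℝ E := by
  classical
  set K : ℕ := ⌊(1 + 2 * R / r) ^ finrank ℝ E⌋₊ with hK
  let p : ℕ → Prop := fun k => ∃ N : Finset A, N.card = k ∧
    (N : Set A).Pairwise fun a b => r < dist a b
  have hp : ∀ N : Finset A, ((N : Set A).Pairwise fun a b => r < dist a b) →
      (N.card : ℝ) ≤ (1 + 2 * R / r) ^ finrank ℝ E := by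
    intro N hN
    have := card_le_of_isSeparated hR hr (N.map (Function.Embedding.subtype _)) (x := x) ?_ ?_
    · simpa using this
    · intro y hy
      simp only [Finset.coe_map, Set.mem_image] at hy
      obtain ⟨z, -, rfl⟩ := hy
      exact hA z.2
    · intro y hy z hz hyz
      simp only [Finset.coe_map, Set.mem_image] at hy hz
      obtain ⟨y, hy, rfl⟩ := hy
      obtain ⟨z, hz, rfl⟩ := hz
      exact hN hy hz fun h => hyz (by rw [h])
  have h0 : p 0 := ⟨∅, by simp, by simp⟩
  obtain ⟨N, hNc, hN⟩ := Nat.findGreatest_spec (P := p) (Nat.zero_le K) h0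
  refine ⟨N, fun a => ?_, hp N hN⟩
  -- A point farther than r from all of N could be added to N, against maximality.
  by_contra! hcon
  have ha : a ∉ N := fun h => by have := hcon a h; rw [dist_self] at this; linarith
  have hins : ((insert a N : Finset A) : Set A).Pairwise fun a b => r < dist a b := by
    rw [Finset.coe_insert]
    refine hN.insert fun b hb _ => ⟨hcon b hb, ?_⟩
    rw [dist_comm]; exact hcon b hb
  have hle : (insert a N).card ≤ K := Nat.le_floor (hp _ hins)
  have := Nat.le_findGreatest hle (P := p) ⟨_, rfl, hins⟩
  rw [Finset.card_insert_of_notMem ha, hNc] at this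
  omega

/-! ### Concentration of empirical means. -/

variable {Ξ : Type u} [MeasurableSpace Ξ]

lemma integral_empirical {n : ℕ} [NeZero n] (x : Fin n → Ξ) {g : Ξ → ℝ} (hg : Measurable g) :
    ∫ ξ, g ξ ∂(empirical x) = (n : ℝ)⁻¹ * ∑ i, g (x i) := by
  rw [empirical, integral_smul_measure, integral_finsetSum_measure]
  · simp [integral_dirac' _ _ hg.stronglyMeasurable]
  · intro i _
    exact integrable_dirac' hg.stronglyMeasurable (by simp)

/-- Hoeffding's inequality for the empirical mean of a bounded function. -/
lemma measure_empirical_deviation_le (P : Measure Ξ) [IsProbabilityMeasure P] {n : ℕ} [NeZero n]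
    {g : Ξ → ℝ} (hg : Measurable g) {m B η : ℝ} (hB : 0 < B) (hη : 0 ≤ η)
    (hgB : ∀ ξ, |g ξ - m| ≤ B) :
    Measure.pi (fun _ : Fin n => P)
      {x | η < |∫ ξ, g ξ ∂(empirical x) - ∫ ξ, g ξ ∂P|} ≤
        ENNReal.ofReal (2 * Real.exp (-(n * η ^ 2 / (2 * B ^ 2)))) := by
  have hn : (0 : ℝ) < n := by exact_mod_cast Nat.pos_of_ne_zero (NeZero.ne n)
  have one_side : ∀ {g : Ξ → ℝ} {m : ℝ}, Measurable g → (∀ ξ, |g ξ - m| ≤ B) →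
      (Measure.pi (fun _ : Fin n => P)).real
        {x | n * η ≤ ∑ i, (g (x i) - ∫ ξ, g ξ ∂P)} ≤
        Real.exp (-(n * η ^ 2 / (2 * B ^ 2))) := by
    intro g m hg hgB
    -- A variable with values in [m-B, m+B] is sub-Gaussian with variance proxy B². The sum of n
    -- copies has proxy nB², and the level nη gives the exponent -nη²/(2B²).
    have hsub : HasSubgaussianMGF (fun ξ => g ξ - ∫ ξ, g ξ ∂P)
        ((‖(m + B) - (m - B)‖₊ / 2) ^ 2) P := by
      refine hasSubgaussianMGF_of_mem_Icc hg.aemeasurable (Filter.Eventually.of_forall fun ξ => ?_)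
      have := abs_le.1 (hgB ξ)
      constructor <;> linarith
    have hi : iIndepFun (fun (i : Fin n) (x : Fin n → Ξ) => g (x i) - ∫ ξ, g ξ ∂P)
        (Measure.pi fun _ : Fin n => P) :=
      iIndepFun_pi (X := fun _ ξ => g ξ - ∫ ξ, g ξ ∂P)
        (fun _ => (hg.sub_const _).aemeasurable)
    have hs : ∀ i ∈ (Finset.univ : Finset (Fin n)),
        HasSubgaussianMGF (fun x : Fin n → Ξ => g (x i) - ∫ ξ, g ξ ∂P)
          ((‖(m + B) - (m - B)‖₊ / 2) ^ 2) (Measure.pi fun _ : Fin n => P) := by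
      intro i _
      refine HasSubgaussianMGF.of_map (Y := fun x : Fin n → Ξ => x i)
        (X := fun ξ => g ξ - ∫ ξ, g ξ ∂P) (measurable_pi_apply i).aemeasurable ?_
      rw [(measurePreserving_eval (fun _ : Fin n => P) i).map_eq]
      exact hsub
    refine (HasSubgaussianMGF.measure_sum_ge_le_of_iIndepFun hi hs (ε := n * η)
      (by positivity)).trans (Real.exp_le_exp.2 (le_of_eq ?_))
    have : ((‖(m + B) - (m - B)‖₊ : NNReal) : ℝ) = 2 * B := by
      rw [coe_nnnorm, Real.norm_eq_abs, abs_of_pos (by linarith)]; ring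
    simp only [Finset.sum_const, Finset.card_univ, Fintype.card_fin, nsmul_eq_mul]
    push_cast
    rw [show ‖(m + B) - (m - B)‖ = 2 * B from this]
    field_simp
    try ring
  have h1 := one_side hg hgB
  have h2 := one_side (g := fun ξ => -g ξ) (m := -m) hg.neg (fun ξ => by
    rw [← abs_neg]; convert hgB ξ using 2; ring)
  have hsub : {x : Fin n → Ξ | η < |∫ ξ, g ξ ∂(empirical x) - ∫ ξ, g ξ ∂P|} ⊆
      {x | n * η ≤ ∑ i, (g (x i) - ∫ ξ, g ξ ∂P)} ∪
      {x | n * η ≤ ∑ i, (-g (x i) - ∫ ξ, -g ξ ∂P)} := by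
    intro x hx
    simp only [Set.mem_ofPred_eq] at hx
    rw [integral_empirical x hg] at hx
    simp only [Set.mem_union, Set.mem_ofPred_eq, Finset.sum_sub_distrib, Finset.sum_const,
      Finset.card_univ, Fintype.card_fin, nsmul_eq_mul, integral_neg, Finset.sum_neg_distrib]
    rcases lt_abs.1 hx with h | h
    · left
      have := mul_lt_mul_of_pos_left h hn
      rw [mul_sub, mul_inv_cancel_left₀ hn.ne'] at this
      exact this.le
    · right
      have := mul_lt_mul_of_pos_left h hn
      rw [mul_neg, mul_sub, mul_inv_cancel_left₀ hn.ne'] at this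
      linarith
  refine (measure_mono hsub).trans ((measure_union_le _ _).trans ?_)
  rw [two_mul, ENNReal.ofReal_add (by positivity) (by positivity)]
  rw [← ofReal_measureReal, ← ofReal_measureReal]
  gcongr

/-! ### The controlled process and one-step inequalities along policies. -/

variable {dS dA d : ℕ}
namespace SOC

lemma map_eval_zero_law (M : SOC dS dA Ξ) (P : Measure Ξ) [IsProbabilityMeasure P]
    (π : M.Policy) (s : M.S) :
    (M.law P π s).map (fun ω => ω 0) = (π.act 0 (s, Fin.elim0)).prod P := by
  have h1 : (M.law P π s).map (Preorder.frestrictLe 0) =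
      ((π.act 0 (s, Fin.elim0)).prod P).map
        (MeasurableEquiv.piUnique (fun _ : Finset.Iic (0 : ℕ) => M.A × Ξ)).symm := by
    rw [law, Kernel.trajMeasure, Measure.map_comp _ _ (by fun_prop), Kernel.traj_map_frestrictLe,
      Kernel.partialTraj_self, Measure.id_comp]
  have h2 : (fun ω : ℕ → M.A × Ξ => ω 0) =
      (MeasurableEquiv.piUnique (fun _ : Finset.Iic (0 : ℕ) => M.A × Ξ)) ∘
        (Preorder.frestrictLe 0) := by
    ext ω : 1
    rfl
  rw [h2, ← Measure.map_map (by fun_prop) (by fun_prop), h1, Measure.map_map (by fun_prop)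
    (by fun_prop), MeasurableEquiv.self_comp_symm, Measure.map_id]

/-- Given the history before stage `t`, the action of stage `t` is drawn from the policy and the
noise of stage `t` from `P`. -/
lemma integral_law_step (M : SOC dS dA Ξ) (P : Measure Ξ) [IsProbabilityMeasure P]
    (π : M.Policy) (s : M.S) (t : ℕ) {G : (M.S × (Fin t → M.A × Ξ)) × (M.A × Ξ) → ℝ}
    (hG : Measurable G) {K : ℝ} (hK : ∀ p, |G p| ≤ K) :
    ∫ ω, G ((s, fun i => ω i), ω t) ∂(M.law P π s) =
      ∫ ω, ∫ a, ∫ ξ, G ((s, fun i => ω i), (a, ξ)) ∂P ∂(π.act t (s, fun i => ω i))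
        ∂(M.law P π s) := by
  have hprod : ∀ h : M.S × (Fin t → M.A × Ξ),
      ∫ p, G (h, p) ∂((π.act t h).prod P) = ∫ a, ∫ ξ, G (h, (a, ξ)) ∂P ∂(π.act t h) := fun h =>
    integral_prod _ (integrable_of_abs_le (by fun_prop) fun p => hK _)
  have : IsProbabilityMeasure (M.law P π s) := by unfold law; infer_instance
  cases t with
  -- Stage 0 comes from the initial law of the trajectory measure and not from `stepKernel`, so it
  -- is treated separately.
  | zero =>
    have hc : ∀ ω : ℕ → M.A × Ξ, (fun i : Fin 0 => ω i) = Fin.elim0 := fun ω => by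
      ext i : 1; exact i.elim0
    simp only [hc]
    rw [← hprod, integral_const, ← map_eval_zero_law, integral_map
      (measurable_pi_apply 0).aemeasurable
      (hG.comp measurable_prodMk_left).aestronglyMeasurable]
    simp
  | succ n =>
    have key := Kernel.map_frestrictLe_trajMeasure_compProd_eq_map_trajMeasure
      (X := fun _ => M.A × Ξ) (μ₀ := (π.act 0 (s, Fin.elim0)).prod P)
      (κ := M.stepKernel P π s) (a := n)
    have hmeas : Measurable fun p : ((i : Finset.Iic n) → M.A × Ξ) × (M.A × Ξ) =>
        G (M.history s n p.1, p.2) :=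
      hG.comp (((M.measurable_history s n).comp measurable_fst).prodMk measurable_snd)
    have hfr : Measurable fun ω : ℕ → M.A × Ξ =>
        (Preorder.frestrictLe (π := fun _ => M.A × Ξ) n ω, ω (n + 1)) := by fun_prop
    calc ∫ ω, G ((s, fun i => ω i), ω (n + 1)) ∂(M.law P π s)
        = ∫ p, G (M.history s n p.1, p.2) ∂((M.law P π s).map (fun ω : ℕ → M.A × Ξ =>
        (Preorder.frestrictLe (π := fun _ => M.A × Ξ) n ω, ω (n + 1)))) := by
          rw [integral_map hfr.aemeasurable hmeas.aestronglyMeasurable]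
          rfl
      _ = ∫ h, ∫ p, G (M.history s n h, p) ∂(M.stepKernel P π s n h)
            ∂((M.law P π s).map (Preorder.frestrictLe n)) := by
          rw [law, ← key, Measure.integral_compProd]
          exact integrable_of_abs_le hmeas fun p => hK _
      _ = ∫ ω, ∫ p, G (M.history s n (Preorder.frestrictLe n ω), p)
            ∂(M.stepKernel P π s n (Preorder.frestrictLe n ω)) ∂(M.law P π s) := by
          rw [integral_map (by fun_prop)]
          exact (StronglyMeasurable.integral_kernel_prod_right'
            (f := fun p : ((i : Finset.Iic n) → M.A × Ξ) × (M.A × Ξ) =>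
              G (M.history s n p.1, p.2)) hmeas.stronglyMeasurable).aestronglyMeasurable
      _ = _ := by
          congr 1
          ext ω
          rw [← hprod]
          simp only [stepKernel, Kernel.prod_apply, Kernel.comap_apply, Kernel.const_apply]
          rfl

lemma integrable_law_step (M : SOC dS dA Ξ) (P : Measure Ξ) [IsProbabilityMeasure P]
    (π : M.Policy) (s : M.S) (t : ℕ) {G : (M.S × (Fin t → M.A × Ξ)) × (M.A × Ξ) → ℝ}
    (hG : Measurable G) {K : ℝ} (hK : ∀ p, |G p| ≤ K) :
    Integrable (fun ω => ∫ a, ∫ ξ, G ((s, fun i => ω i), (a, ξ)) ∂P ∂(π.act t (s, fun i => ω i)))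
      (M.law P π s) := by
  have : IsProbabilityMeasure (M.law P π s) := by unfold law; infer_instance
  have hprod : ∀ h : M.S × (Fin t → M.A × Ξ),
      ∫ p, G (h, p) ∂((π.act t ×ₖ Kernel.const _ P) h) =
        ∫ a, ∫ ξ, G (h, (a, ξ)) ∂P ∂(π.act t h) := fun h => by
    rw [Kernel.prod_apply, Kernel.const_apply]
    exact integral_prod _ (integrable_of_abs_le (by fun_prop) fun p => hK _)
  have hmeas := (StronglyMeasurable.integral_kernel_prod_right'
    (κ := π.act t ×ₖ Kernel.const _ P) hG.stronglyMeasurable).measurable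
  simp only [← hprod]
  refine integrable_of_abs_le (K := K) ?_ fun ω => ?_
  · refine hmeas.comp (measurable_const.prodMk (measurable_pi_lambda _ fun i => ?_))
    exact measurable_pi_apply _
  · have h := abs_integral_sub_le (μ := (π.act t ×ₖ Kernel.const _ P) (s, fun i => ω i)) (m := 0)
      (integrable_of_abs_le (K := K) (g := fun p => G ((s, fun i => ω i), p)) (by fun_prop)
        fun p => hK _) (K := K) (fun p => by simpa using hK _)
    simpa using h

/-- State and accumulated cost at stage `t` as a function of the history. -/
def ctrl (M : SOC dS dA Ξ) : (t : ℕ) → M.S × (Fin t → M.A × Ξ) → M.S × ℝ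
  | 0 => fun h => (h.1, 0)
  | t + 1 => fun h =>
    (M.F (M.ctrl t (h.1, Fin.init h.2)).1 (h.2 (Fin.last t)).1 (h.2 (Fin.last t)).2,
      (M.ctrl t (h.1, Fin.init h.2)).2 +
        M.γ ^ t * M.c (M.ctrl t (h.1, Fin.init h.2)).1 (h.2 (Fin.last t)).1)

lemma measurable_ctrl (M : SOC dS dA Ξ) (t : ℕ) : Measurable (M.ctrl t) := by
  induction t with
  | zero => exact measurable_fst.prodMk measurable_const
  | succ t ih =>
    have h0 : Measurable fun h : M.S × (Fin (t + 1) → M.A × Ξ) =>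
        M.ctrl t (h.1, Fin.init h.2) := by
      refine ih.comp (measurable_fst.prodMk (measurable_pi_lambda _ fun i => ?_))
      exact (measurable_pi_apply (Fin.castSucc i)).comp measurable_snd
    have h1 : Measurable fun h : M.S × (Fin (t + 1) → M.A × Ξ) => h.2 (Fin.last t) :=
      (measurable_pi_apply _).comp measurable_snd
    refine Measurable.prodMk ?_ ?_
    · exact M.measurable_F.comp
        ((measurable_fst.comp h0).prodMk ((measurable_fst.comp h1).prodMk (measurable_snd.comp h1)))
    · exact (measurable_snd.comp h0).add ((M.continuous_c.measurable.comp
        ((measurable_fst.comp h0).prodMk (measurable_fst.comp h1))).const_mul _)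

/-- Links the function of the finite history, on which policies can depend measurably, with the
recursively defined trajectory. -/
lemma ctrl_eq (M : SOC dS dA Ξ) (s : M.S) (ω : ℕ → M.A × Ξ) (t : ℕ) :
    M.ctrl t (s, fun i => ω i) =
      (M.state s ω t, ∑ i ∈ Finset.range t, M.γ ^ i * M.c (M.state s ω i) (ω i).1) := by
  induction t with
  | zero => rfl
  | succ t ih =>
    have : (Fin.init fun i : Fin (t + 1) => ω i) = fun i : Fin t => ω i := by
      ext i : 1; rfl
    simp only [ctrl, this, ih, Finset.sum_range_succ, state, Fin.val_last]

lemma one_sub_pos (M : SOC dS dA Ξ) : 0 < 1 - M.γ := by linarith [M.γ_lt_one]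

lemma geom_sum_le (M : SOC dS dA Ξ) (t : ℕ) :
    ∑ i ∈ Finset.range t, M.γ ^ i ≤ 1 / (1 - M.γ) := by
  rw [one_div, ← tsum_geometric_of_lt_one M.γ_nonneg M.γ_lt_one]
  exact (summable_geometric_of_lt_one M.γ_nonneg M.γ_lt_one).sum_le_tsum _
    fun i _ => pow_nonneg M.γ_nonneg i

lemma ctrl_snd_mem (M : SOC dS dA Ξ) (t : ℕ) (h : M.S × (Fin t → M.A × Ξ)) :
    (M.ctrl t h).2 ∈ Set.Icc 0 (1 / (1 - M.γ)) := by
  have : (M.ctrl t h).2 ∈ Set.Icc 0 (∑ i ∈ Finset.range t, M.γ ^ i) := by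
    induction t with
    | zero => simp [ctrl]
    | succ t ih =>
      have h1 := ih (h.1, Fin.init h.2)
      have h2 := M.c_mem (M.ctrl t (h.1, Fin.init h.2)).1 (h.2 (Fin.last t)).1
      have h3 := pow_nonneg M.γ_nonneg t
      rw [Finset.sum_range_succ]
      exact ⟨add_nonneg h1.1 (mul_nonneg h3 h2.1),
        add_le_add h1.2 (mul_le_of_le_one_right h3 h2.2)⟩
  exact ⟨this.1, this.2.trans (M.geom_sum_le t)⟩

instance (M : SOC dS dA Ξ) (P : Measure Ξ) [IsProbabilityMeasure P] (π : M.Policy) (s : M.S) :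
    IsProbabilityMeasure (M.law P π s) := by
  unfold law; infer_instance

/-- Dynamics of the expectation of a function of the state and the accumulated cost. -/
lemma integral_ctrl_succ (M : SOC dS dA Ξ) (Q : Measure Ξ) [IsProbabilityMeasure Q]
    (π : M.Policy) (s : M.S) (t : ℕ) {V : M.S → ℝ → ℝ}
    (hV : Measurable fun p : M.S × ℝ => V p.1 p.2) {K : ℝ}
    (hK : ∀ s, ∀ z ∈ Set.Icc 0 (1 / (1 - M.γ)), |V s z| ≤ K) :
    let I : (ℕ → M.A × Ξ) → ℝ := fun ω => ∫ a, ∫ ξ, V (M.F (M.ctrl t (s, fun i => ω i)).1 a ξ)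
        ((M.ctrl t (s, fun i => ω i)).2 + M.γ ^ t * M.c (M.ctrl t (s, fun i => ω i)).1 a) ∂Q
        ∂(π.act t (s, fun i => ω i))
    Integrable I (M.law Q π s) ∧
      ∫ ω, V (M.ctrl (t + 1) (s, fun i => ω i)).1 (M.ctrl (t + 1) (s, fun i => ω i)).2
        ∂(M.law Q π s) = ∫ ω, I ω ∂(M.law Q π s) := by
  intro I
  have hsnoc : Measurable fun p : (M.S × (Fin t → M.A × Ξ)) × (M.A × Ξ) =>
      ((p.1.1, Fin.snoc p.1.2 p.2) : M.S × (Fin (t + 1) → M.A × Ξ)) := by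
    refine (measurable_fst.comp measurable_fst).prodMk (measurable_pi_lambda _ fun i => ?_)
    refine Fin.lastCases ?_ (fun i => ?_) i
    · simpa using measurable_snd
    · simp only [Fin.snoc_castSucc]
      exact (measurable_pi_apply i).comp (measurable_snd.comp measurable_fst)
  have hG := hV.comp ((M.measurable_ctrl (t + 1)).comp hsnoc)
  have h1 := M.integral_law_step Q π s t hG (K := K) fun p => hK _ _ (M.ctrl_snd_mem _ _)
  have h2 := M.integrable_law_step Q π s t hG (K := K) fun p => hK _ _ (M.ctrl_snd_mem _ _)
  have h3 : I = fun ω => ∫ a, ∫ ξ, ((fun p : M.S × ℝ => V p.1 p.2) ∘ M.ctrl (t + 1) ∘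
      fun p : (M.S × (Fin t → M.A × Ξ)) × (M.A × Ξ) => (p.1.1, Fin.snoc p.1.2 p.2))
        ((s, fun i => ω i), (a, ξ)) ∂Q ∂(π.act t (s, fun i => ω i)) := by
    ext ω
    simp [ctrl, I]
  rw [← h3] at h1 h2
  refine ⟨h2, ?_⟩
  rw [← h1]
  congr 1
  ext ω
  have : (fun i : Fin (t + 1) => ω i) = Fin.snoc (fun i : Fin t => ω i) (ω t) := by
    ext i : 1
    refine Fin.lastCases ?_ (fun i => ?_) i <;> simp
  simp only [Function.comp, this]

lemma integrable_ctrl (M : SOC dS dA Ξ) (Q : Measure Ξ) [IsProbabilityMeasure Q]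
    (π : M.Policy) (s : M.S) (t : ℕ) {V : M.S → ℝ → ℝ}
    (hV : Measurable fun p : M.S × ℝ => V p.1 p.2) {K : ℝ}
    (hK : ∀ s, ∀ z ∈ Set.Icc 0 (1 / (1 - M.γ)), |V s z| ≤ K) :
    Integrable (fun ω => V (M.ctrl t (s, fun i => ω i)).1 (M.ctrl t (s, fun i => ω i)).2)
      (M.law Q π s) := by
  refine integrable_of_abs_le (K := K) ?_ fun ω => hK _ _ (M.ctrl_snd_mem _ _)
  refine hV.comp ((M.measurable_ctrl t).comp
    (measurable_const.prodMk (measurable_pi_lambda _ fun i => measurable_pi_apply _)))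

lemma measurable_integral_transition (M : SOC dS dA Ξ) (Q : Measure Ξ) [IsProbabilityMeasure Q]
    (s : M.S) (z w : ℝ) {V : M.S → ℝ → ℝ} (hV : Measurable fun p : M.S × ℝ => V p.1 p.2) :
    Measurable fun a => ∫ ξ, V (M.F s a ξ) (z + w * M.c s a) ∂Q := by
  refine (StronglyMeasurable.integral_prod_right
    (f := fun a ξ => V (M.F s a ξ) (z + w * M.c s a)) ?_).measurable
  refine (hV.comp (Measurable.prodMk ?_ ?_)).stronglyMeasurable
  · exact M.measurable_F.comp (measurable_const.prodMk measurable_id)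
  · exact ((M.continuous_c.measurable.comp
      (measurable_const.prodMk measurable_fst)).const_mul _).const_add _

/-- One-step lower bounds add up along every policy. -/
lemma le_integral_of_step (M : SOC dS dA Ξ) (Q : Measure Ξ) [IsProbabilityMeasure Q]
    (π : M.Policy) (s : M.S) {V : ℕ → M.S → ℝ → ℝ}
    (hV : ∀ t, Measurable fun p : M.S × ℝ => V t p.1 p.2) {K e : ℝ} {N : ℕ}
    (hK : ∀ t s, ∀ z ∈ Set.Icc 0 (1 / (1 - M.γ)), |V t s z| ≤ K)
    (hstep : ∀ t < N, ∀ s a, ∀ z ∈ Set.Icc 0 (1 / (1 - M.γ)),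
      V t s z ≤ ∫ ξ, V (t + 1) (M.F s a ξ) (z + M.γ ^ t * M.c s a) ∂Q + e) :
    V 0 s 0 ≤ ∫ ω, V N (M.ctrl N (s, fun i => ω i)).1 (M.ctrl N (s, fun i => ω i)).2
      ∂(M.law Q π s) + N * e := by
  induction N with
  | zero => simp [ctrl]
  | succ N ih =>
    obtain ⟨hI, hE⟩ := M.integral_ctrl_succ Q π s N (hV (N + 1)) (hK (N + 1))
    rw [hE]
    have h1 := ih fun t ht => hstep t (by omega)
    have h2 := integral_mono (M.integrable_ctrl Q π s N (hV N) (hK N))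
      (hI.add (integrable_const e)) fun ω => ?_
    · rw [integral_add' hI (integrable_const e)] at h2
      simp only [integral_const, probReal_univ, one_smul] at h2
      push_cast
      linarith
    · set x := M.ctrl N (s, fun i => ω i) with hx
      have hz : x.2 ∈ Set.Icc 0 (1 / (1 - M.γ)) := M.ctrl_snd_mem _ _
      have hle : ∀ a, V N x.1 x.2 - e ≤
          ∫ ξ, V (N + 1) (M.F x.1 a ξ) (x.2 + M.γ ^ N * M.c x.1 a) ∂Q := fun a => by
        have := hstep N (by omega) x.1 a x.2 hz
        linarith
      have hmeas := M.measurable_integral_transition Q x.1 x.2 (M.γ ^ N) (hV (N + 1))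
      -- The bound K is available only for z in [0, 1/(1-γ)]. The updated cost lies there because it
      -- is the accumulated cost of a history one stage longer; any noise value completes that
      -- history.
      have hmem : ∀ a, x.2 + M.γ ^ N * M.c x.1 a ∈ Set.Icc 0 (1 / (1 - M.γ)) := fun a => by
        obtain ⟨ξ⟩ := Q.nonempty_of_neZero
        have := M.ctrl_snd_mem (N + 1) (s, Fin.snoc (fun i : Fin N => ω i) (a, ξ))
        simpa [ctrl, hx] using this
      have hint : Integrable (fun a =>
          ∫ ξ, V (N + 1) (M.F x.1 a ξ) (x.2 + M.γ ^ N * M.c x.1 a) ∂Q)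
          (π.act N (s, fun i => ω i)) := by
        refine integrable_of_abs_le (K := K) hmeas fun a => ?_
        have := norm_integral_le_of_norm_le_const (μ := Q) (C := K)
          (f := fun ξ => V (N + 1) (M.F x.1 a ξ) (x.2 + M.γ ^ N * M.c x.1 a))
          (Filter.Eventually.of_forall fun ξ => hK _ _ _ (hmem a))
        simpa using this
      have h3 := integral_mono (integrable_const (V N x.1 x.2 - e)) hint hle
      simp only [integral_const, probReal_univ, one_smul] at h3
      simp only [Pi.add_apply]
      linarith

/-- The policy that applies a feedback law in the state and the accumulated cost. -/
def feedback (M : SOC dS dA Ξ) (α : ℕ → M.S × ℝ → M.A) (hα : ∀ t, Measurable (α t)) :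
    M.Policy where
  act t := Kernel.deterministic (fun h => α t (M.ctrl t h)) ((hα t).comp (M.measurable_ctrl t))
  markov _ := inferInstance

/-- One-step upper bounds add up along a feedback policy. -/
lemma integral_feedback_le_of_step (M : SOC dS dA Ξ) (Q : Measure Ξ) [IsProbabilityMeasure Q]
    (s : M.S) {V : ℕ → M.S → ℝ → ℝ}
    (hV : ∀ t, Measurable fun p : M.S × ℝ => V t p.1 p.2) {K e : ℝ} {N : ℕ}
    (hK : ∀ t s, ∀ z ∈ Set.Icc 0 (1 / (1 - M.γ)), |V t s z| ≤ K)
    (α : ℕ → M.S × ℝ → M.A) (hα : ∀ t, Measurable (α t))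
    (hstep : ∀ t < N, ∀ s, ∀ z ∈ Set.Icc 0 (1 / (1 - M.γ)),
      ∫ ξ, V (t + 1) (M.F s (α t (s, z)) ξ) (z + M.γ ^ t * M.c s (α t (s, z))) ∂Q
        ≤ V t s z + e) :
    ∫ ω, V N (M.ctrl N (s, fun i => ω i)).1 (M.ctrl N (s, fun i => ω i)).2
      ∂(M.law Q (M.feedback α hα) s) ≤ V 0 s 0 + N * e := by
  induction N with
  | zero => simp [ctrl]
  | succ N ih =>
    obtain ⟨hI, hE⟩ :=
      M.integral_ctrl_succ Q (M.feedback α hα) s N (hV (N + 1)) (hK (N + 1))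
    rw [hE]
    have h1 := ih fun t ht => hstep t (by omega)
    have hN := M.integrable_ctrl Q (M.feedback α hα) s N (hV N) (hK N)
    have h2 := integral_mono hI (hN.add (integrable_const e)) fun ω => ?_
    · rw [integral_add' hN (integrable_const e)] at h2
      simp only [integral_const, probReal_univ, one_smul] at h2
      push_cast
      linarith
    · set x := M.ctrl N (s, fun i => ω i) with hx
      have hz : x.2 ∈ Set.Icc 0 (1 / (1 - M.γ)) := M.ctrl_snd_mem _ _
      have hmeas := M.measurable_integral_transition Q x.1 x.2 (M.γ ^ N) (hV (N + 1))
      simp only [feedback, Pi.add_apply]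
      rw [Kernel.deterministic_apply, integral_dirac' _ _ hmeas.stronglyMeasurable]
      exact hstep N (by omega) x.1 x.2 hz

end SOC

/-! ### Measurable near-minimizers. -/

/-- Measurable selection of approximate minimizers of a Carathéodory function. -/
lemma exists_measurable_approx_argmin {X A : Type*} [MeasurableSpace X] [TopologicalSpace A]
    [TopologicalSpace.SeparableSpace A] [Nonempty A] [MeasurableSpace A] {J : X → A → ℝ}
    (hm : ∀ a, Measurable fun x => J x a) (hW : Measurable fun x => ⨅ a, J x a)
    (hc : ∀ x, Continuous (J x)) {η : ℝ} (hη : 0 < η) :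
    ∃ α : X → A, Measurable α ∧ ∀ x, J x (α x) ≤ (⨅ a, J x a) + η := by
  classical
  -- The strict near-minimizers form a nonempty open set, which meets the dense sequence. Taking the
  -- first index that works makes the selection measurable.
  have hex : ∀ x, ∃ k, J x (TopologicalSpace.denseSeq A k) < (⨅ a, J x a) + η := by
    intro x
    obtain ⟨a, ha⟩ := exists_lt_of_ciInf_lt (lt_add_of_pos_right (⨅ a, J x a) hη)
    have hopen : IsOpen {a | J x a < (⨅ a, J x a) + η} :=
      isOpen_lt (hc x) continuous_const
    obtain ⟨_, h, k, rfl⟩ := (TopologicalSpace.denseRange_denseSeq A).inter_open_nonempty _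
      hopen ⟨a, ha⟩
    exact ⟨k, h⟩
  refine ⟨fun x => TopologicalSpace.denseSeq A (Nat.find (hex x)), ?_, fun x =>
    (Nat.find_spec (hex x)).le⟩
  exact (measurable_from_nat).comp (measurable_find hex fun k =>
    measurableSet_lt (hm _) (hW.add_const η))

/-! ### Regularity of the value functions. -/

namespace SOC

lemma IsLipschitz.mono {M : SOC dS dA Ξ} {L ℓ R : ℝ} (h : M.IsLipschitz L R) (hL : L ≤ ℓ) :
    M.IsLipschitz ℓ R where
  cost s s' a a' := (h.cost s s' a a').trans
    (mul_le_mul_of_nonneg_right hL (Real.sqrt_nonneg _))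
  transition s s' a a' ξ := (h.transition s s' a a' ξ).trans
    (mul_le_mul_of_nonneg_right hL (Real.sqrt_nonneg _))
  radius_S := h.radius_S
  radius_A := h.radius_A

lemma sqrt_sq_add_sq_le {x y : ℝ} (hx : 0 ≤ x) (hy : 0 ≤ y) : √(x ^ 2 + y ^ 2) ≤ x + y :=
  Real.sqrt_le_iff.2 ⟨by positivity, by nlinarith [mul_nonneg hx hy]⟩

lemma IsLipschitz.abs_cost_sub_le {M : SOC dS dA Ξ} {ℓ R : ℝ} (h : M.IsLipschitz ℓ R)
    (hℓ : 0 ≤ ℓ) (s s' : M.S) (a a' : M.A) :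
    |M.c s a - M.c s' a'| ≤ ℓ * (dist s s' + dist a a') :=
  (h.cost s s' a a').trans
    (mul_le_mul_of_nonneg_left (sqrt_sq_add_sq_le dist_nonneg dist_nonneg) hℓ)

lemma IsLipschitz.dist_transition_le {M : SOC dS dA Ξ} {ℓ R : ℝ} (h : M.IsLipschitz ℓ R)
    (hℓ : 0 ≤ ℓ) (s s' : M.S) (a a' : M.A) (ξ : Ξ) :
    dist (M.F s a ξ) (M.F s' a' ξ) ≤ ℓ * (dist s s' + dist a a') :=
  (h.transition s s' a a' ξ).trans
    (mul_le_mul_of_nonneg_left (sqrt_sq_add_sq_le dist_nonneg dist_nonneg) hℓ)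

/-- Optimal value of the problem with `m` stages to go, current weight `w`, state `s` and
accumulated cost `z`, for the terminal cost `f`. -/
def value (M : SOC dS dA Ξ) (P : Measure Ξ) (f : ℝ → ℝ) : ℕ → ℝ → M.S → ℝ → ℝ
  | 0, _, _, z => f z
  | m + 1, w, s, z => ⨅ a, ∫ ξ, M.value P f m (M.γ * w) (M.F s a ξ) (z + w * M.c s a) ∂P

instance (M : SOC dS dA Ξ) : Nonempty M.A := M.nonempty_A.to_subtype

section value
variable {M : SOC dS dA Ξ} {P : Measure Ξ} [IsProbabilityMeasure P] {f : ℝ → ℝ} {LC ℓ R : ℝ}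

/-- The regularity of the value function that is preserved by the Bellman operator: a Lipschitz
bound with constant `κ` in the state, and boundedness. -/
structure IsRegular (V : M.S → ℝ → ℝ) (f : ℝ → ℝ) (LC κ B : ℝ) : Prop where
  lip : ∀ s s' z z', |V s z - V s' z'| ≤ κ * dist s s' + LC * |z - z'|
  bdd : ∀ s z, |V s z - f z| ≤ B

lemma IsRegular.continuous {V : M.S → ℝ → ℝ} {κ B : ℝ} (h : IsRegular V f LC κ B) :
    Continuous fun p : M.S × ℝ => V p.1 p.2 := by
  rw [continuous_iff_continuousAt]
  intro p
  rw [ContinuousAt, tendsto_iff_dist_tendsto_zero]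
  refine squeeze_zero (fun _ => dist_nonneg)
    (fun q => (h.lip q.1 p.1 q.2 p.2 : dist (V q.1 q.2) (V p.1 p.2) ≤ _)) ?_
  have : Continuous fun q : M.S × ℝ => κ * dist q.1 p.1 + LC * |q.2 - p.2| := by fun_prop
  simpa using this.tendsto p

lemma IsRegular.integrable {V : M.S → ℝ → ℝ} {κ B : ℝ} (h : IsRegular V f LC κ B) (Q : Measure Ξ)
    [IsProbabilityMeasure Q] (s : M.S) (a : M.A) (z : ℝ) :
    Integrable (fun ξ => V (M.F s a ξ) z) Q := by
  refine integrable_of_abs_le (K := |f z| + B) ?_ fun ξ => ?_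
  · exact h.continuous.measurable.comp
      ((M.measurable_F.comp (measurable_const.prodMk
        (measurable_const.prodMk measurable_id))).prodMk measurable_const)
  · have h1 := h.bdd (M.F s a ξ) z
    have h2 := abs_add_le (V (M.F s a ξ) z - f z) (f z)
    rw [sub_add_cancel] at h2
    linarith

/-- Both trajectories are driven by the same noise, so the comparison is pointwise in ξ: the next
state contributes ℓκ, and the stage cost, whose weight is at most 1, contributes ℓ L_C. -/
lemma IsRegular.abs_integral_sub_le {V : M.S → ℝ → ℝ} {κ B : ℝ} (h : IsRegular V f LC κ B)
    (hLC : 0 ≤ LC) (hκ : 0 ≤ κ) (hℓ : 0 ≤ ℓ) (hM : M.IsLipschitz ℓ R) {w : ℝ} (hw : 0 ≤ w)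
    (hw1 : w ≤ 1) (Q : Measure Ξ) [IsProbabilityMeasure Q] (s s' : M.S) (a a' : M.A) (z z' : ℝ) :
    |∫ ξ, V (M.F s a ξ) (z + w * M.c s a) ∂Q - ∫ ξ, V (M.F s' a' ξ) (z' + w * M.c s' a') ∂Q| ≤
      ℓ * (κ + LC) * (dist s s' + dist a a') + LC * |z - z'| := by
  refine abs_integral_sub_integral_le (h.integrable Q _ _ _) (h.integrable Q _ _ _) fun ξ => ?_
  refine (h.lip _ _ _ _).trans ?_
  have h1 := mul_le_mul_of_nonneg_left (hM.dist_transition_le hℓ s s' a a' ξ) hκ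
  have h2 : |z + w * M.c s a - (z' + w * M.c s' a')| ≤
      |z - z'| + ℓ * (dist s s' + dist a a') := by
    have e : z + w * M.c s a - (z' + w * M.c s' a') =
        (z - z') + w * (M.c s a - M.c s' a') := by ring
    rw [e]
    refine (abs_add_le _ _).trans ?_
    rw [abs_mul, abs_of_nonneg hw]
    have := hM.abs_cost_sub_le hℓ s s' a a'
    have := mul_le_of_le_one_left (abs_nonneg (M.c s a - M.c s' a')) hw1
    linarith
  have h3 := mul_le_mul_of_nonneg_left h2 hLC
  linarith

/-- The geometric series in one step: the current stage moves z by at most w and the later ones by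
at most γw/(1-γ), which add up to w/(1-γ). -/
lemma IsRegular.abs_integral_sub_terminal_le {V : M.S → ℝ → ℝ} {κ w : ℝ}
    (h : IsRegular V f LC κ (LC * (M.γ * w) / (1 - M.γ)))
    (hf : ∀ z z', |f z - f z'| ≤ LC * |z - z'|) (hLC : 0 ≤ LC) (hw : 0 ≤ w)
    (Q : Measure Ξ) [IsProbabilityMeasure Q] (s : M.S) (a : M.A) (z : ℝ) :
    |∫ ξ, V (M.F s a ξ) (z + w * M.c s a) ∂Q - f z| ≤ LC * w / (1 - M.γ) := by
  refine RiskSOC.abs_integral_sub_le (h.integrable Q _ _ _) fun ξ => ?_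
  have h1 := h.bdd (M.F s a ξ) (z + w * M.c s a)
  have h2 := hf (z + w * M.c s a) z
  have hc := M.c_mem s a
  rw [add_sub_cancel_left, abs_of_nonneg (mul_nonneg hw hc.1)] at h2
  have h3 : LC * (w * M.c s a) ≤ LC * w :=
    mul_le_mul_of_nonneg_left (mul_le_of_le_one_right hw hc.2) hLC
  have h4 := abs_sub_le (V (M.F s a ξ) (z + w * M.c s a)) (f (z + w * M.c s a)) (f z)
  have h5 : LC * w / (1 - M.γ) = LC * (M.γ * w) / (1 - M.γ) + LC * w := by
    have := M.one_sub_pos.ne'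
    field_simp
    ring
  linarith

/-- Infima and expectations preserve uniform bounds, so the constants follow a scalar recursion: κ
becomes ℓ(κ + L_C), and the constant L_C in z is unchanged. -/
lemma isRegular_value (hf : ∀ z z', |f z - f z'| ≤ LC * |z - z'|) (hLC : 0 ≤ LC) (hℓ : 1 ≤ ℓ)
    (hM : M.IsLipschitz ℓ R) (m : ℕ) {w : ℝ} (hw : 0 ≤ w) (hw1 : w ≤ 1) :
    IsRegular (M.value P f m w) f LC (LC * ((2 * ℓ) ^ m - 1)) (LC * w / (1 - M.γ)) := by
  have hb := M.one_sub_pos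
  induction m generalizing w with
  | zero =>
    refine ⟨fun s s' z z' => by simpa [value] using hf z z', fun s z => ?_⟩
    simp only [value, sub_self, abs_zero]
    positivity
  | succ m ih =>
    have hγw : 0 ≤ M.γ * w := mul_nonneg M.γ_nonneg hw
    have hV := ih hγw (mul_le_one₀ M.γ_lt_one.le hw hw1)
    have hp : (1 : ℝ) ≤ (2 * ℓ) ^ m := one_le_pow₀ (by linarith)
    have hbd := fun s z a => hV.abs_integral_sub_terminal_le hf hLC hw P s a z
    have hbdd : ∀ s z, BddBelow (Set.range fun a =>
        ∫ ξ, M.value P f m (M.γ * w) (M.F s a ξ) (z + w * M.c s a) ∂P) := fun s z =>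
      bddBelow_range_of_abs_sub_le (hbd s z)
    refine ⟨fun s s' z z' => ?_, fun s z => ?_⟩
    · refine abs_ciInf_sub_ciInf_le (hbdd s z) (hbdd s' z') fun a => ?_
      refine (hV.abs_integral_sub_le hLC (mul_nonneg hLC (by linarith)) (by linarith) hM hw hw1
        P s s' a a z z').trans ?_
      rw [dist_self, add_zero]
      refine add_le_add (mul_le_mul_of_nonneg_right ?_ dist_nonneg) le_rfl
      -- With κ = L_C((2ℓ)^m - 1) the recursion yields L_C ℓ(2ℓ)^m. Doubling the base leaves room
      -- for the subtracted 1, since ℓ(2ℓ)^m ≥ 1.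
      have h1 : ℓ * (LC * ((2 * ℓ) ^ m - 1) + LC) = LC * (ℓ * (2 * ℓ) ^ m) := by ring
      rw [h1, pow_succ]
      have h2 : 1 ≤ ℓ * (2 * ℓ) ^ m := one_le_mul_of_one_le_of_one_le hℓ hp
      exact mul_le_mul_of_nonneg_left (by linarith) hLC
    · have := abs_ciInf_sub_ciInf_le (g' := fun _ : M.A => f z) (hbdd s z) ⟨f z, by simp⟩
        fun a => hbd s z a
      simpa [value] using this

/-- The Bellman operator is nonexpansive in the supremum norm, so a uniform perturbation of the
terminal cost is not amplified. This gives the Lipschitz dependence on θ. -/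
lemma abs_value_sub_value_le {f' : ℝ → ℝ} {K : ℝ} (hf : ∀ z z', |f z - f z'| ≤ LC * |z - z'|)
    (hf' : ∀ z z', |f' z - f' z'| ≤ LC * |z - z'|) (hLC : 0 ≤ LC) (hℓ : 1 ≤ ℓ)
    (hM : M.IsLipschitz ℓ R) (hff' : ∀ z, |f z - f' z| ≤ K) (m : ℕ) {w : ℝ} (hw : 0 ≤ w)
    (hw1 : w ≤ 1) (s : M.S) (z : ℝ) :
    |M.value P f m w s z - M.value P f' m w s z| ≤ K := by
  induction m generalizing w s z with
  | zero => exact hff' z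
  | succ m ih =>
    have hγw : 0 ≤ M.γ * w := mul_nonneg M.γ_nonneg hw
    have hγw1 := mul_le_one₀ M.γ_lt_one.le hw hw1
    have hV := isRegular_value (P := P) hf hLC hℓ hM m hγw hγw1
    have hV' := isRegular_value (P := P) hf' hLC hℓ hM m hγw hγw1
    have hbdd : ∀ {f : ℝ → ℝ}, (∀ z z', |f z - f z'| ≤ LC * |z - z'|) →
        BddBelow (Set.range fun a =>
          ∫ ξ, M.value P f m (M.γ * w) (M.F s a ξ) (z + w * M.c s a) ∂P) := fun hf =>
      bddBelow_range_of_abs_sub_le fun a => (isRegular_value (P := P) hf hLC hℓ hM m hγw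
        hγw1).abs_integral_sub_terminal_le hf hLC hw P s a z
    exact abs_ciInf_sub_ciInf_le (hbdd hf) (hbdd hf') fun a =>
      abs_integral_sub_integral_le (hV.integrable P _ _ _) (hV'.integrable P _ _ _)
        fun ξ => ih hγw hγw1 _ _

end value

end SOC

/-! ### Truncated and total cost. -/

namespace SOC

lemma ctrl_succ_snd_eq (M : SOC dS dA Ξ) (T : ℕ) (s : M.S) (ω : ℕ → M.A × Ξ) :
    (M.ctrl (T + 1) (s, fun i => ω i)).2 = M.truncatedCost T s ω := by
  rw [ctrl_eq]; rfl

lemma truncatedCost_mem (M : SOC dS dA Ξ) (T : ℕ) (s : M.S) (ω : ℕ → M.A × Ξ) :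
    M.truncatedCost T s ω ∈ Set.Icc 0 (1 / (1 - M.γ)) := by
  rw [← ctrl_succ_snd_eq]; exact M.ctrl_snd_mem _ _

lemma measurable_truncatedCost (M : SOC dS dA Ξ) (T : ℕ) (s : M.S) :
    Measurable (M.truncatedCost T s) := by
  have : M.truncatedCost T s = fun ω => (M.ctrl (T + 1) (s, fun i => ω i)).2 := by
    ext ω; rw [ctrl_succ_snd_eq]
  rw [this]
  exact measurable_snd.comp ((M.measurable_ctrl _).comp
    (measurable_const.prodMk (measurable_pi_lambda _ fun i => measurable_pi_apply _)))

lemma term_mem (M : SOC dS dA Ξ) (s : M.S) (ω : ℕ → M.A × Ξ) (t : ℕ) :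
    M.γ ^ t * M.c (M.state s ω t) (ω t).1 ∈ Set.Icc 0 (M.γ ^ t) := by
  have h := M.c_mem (M.state s ω t) (ω t).1
  have hp := pow_nonneg M.γ_nonneg t
  exact ⟨mul_nonneg hp h.1, mul_le_of_le_one_right hp h.2⟩

lemma summable_cost (M : SOC dS dA Ξ) (s : M.S) (ω : ℕ → M.A × Ξ) :
    Summable fun t => M.γ ^ t * M.c (M.state s ω t) (ω t).1 :=
  Summable.of_nonneg_of_le (fun t => (M.term_mem s ω t).1) (fun t => (M.term_mem s ω t).2)
    (summable_geometric_of_lt_one M.γ_nonneg M.γ_lt_one)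

lemma abs_totalCost_sub_le (M : SOC dS dA Ξ) (T : ℕ) (s : M.S) (ω : ℕ → M.A × Ξ) :
    |M.totalCost s ω - M.truncatedCost T s ω| ≤ M.γ ^ (T + 1) / (1 - M.γ) := by
  have h1 := (M.summable_cost s ω).sum_add_tsum_nat_add (T + 1)
  have h2 : M.totalCost s ω - M.truncatedCost T s ω =
      ∑' i, M.γ ^ (i + (T + 1)) * M.c (M.state s ω (i + (T + 1))) (ω (i + (T + 1))).1 := by
    rw [totalCost, truncatedCost, ← h1]; ring
  have h3 : Summable fun i => M.γ ^ (i + (T + 1)) :=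
    (summable_nat_add_iff (T + 1)).2 (summable_geometric_of_lt_one M.γ_nonneg M.γ_lt_one)
  rw [h2, abs_of_nonneg (tsum_nonneg fun i => (M.term_mem s ω _).1)]
  refine (((summable_nat_add_iff (T + 1)).2 (M.summable_cost s ω)).tsum_le_tsum
    (fun i => (M.term_mem s ω (i + (T + 1))).2) h3).trans_eq ?_
  simp_rw [pow_add]
  rw [tsum_mul_right, tsum_geometric_of_lt_one M.γ_nonneg M.γ_lt_one]
  ring

lemma totalCost_mem (M : SOC dS dA Ξ) (s : M.S) (ω : ℕ → M.A × Ξ) :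
    M.totalCost s ω ∈ Set.Icc 0 (1 / (1 - M.γ)) := by
  refine ⟨tsum_nonneg fun i => (M.term_mem s ω _).1, ?_⟩
  rw [one_div, ← tsum_geometric_of_lt_one M.γ_nonneg M.γ_lt_one]
  exact (M.summable_cost s ω).tsum_le_tsum (fun t => (M.term_mem s ω t).2)
    (summable_geometric_of_lt_one M.γ_nonneg M.γ_lt_one)

lemma measurable_totalCost (M : SOC dS dA Ξ) (s : M.S) : Measurable (M.totalCost s) := by
  refine measurable_of_tendsto_metrizable (fun T => M.measurable_truncatedCost T s) ?_
  rw [tendsto_pi_nhds]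
  intro ω
  exact (M.summable_cost s ω).hasSum.tendsto_sum_nat.comp (Filter.tendsto_add_atTop_nat 1)

/-! ### Comparison of optimal risks. -/

section risk
variable {M : SOC dS dA Ξ} {Θ : Set (EuclideanSpace ℝ (Fin d))}
  {f : EuclideanSpace ℝ (Fin d) → ℝ → ℝ} {LC LΘ RΘ ℓ R : ℝ}

lemma measurable_of_abs_sub_le {g : ℝ → ℝ} (hg : ∀ z z', |g z - g z'| ≤ LC * |z - z'|) :
    Measurable g :=
  (LipschitzWith.of_dist_le_mul (K := LC.toNNReal) fun z z' => (hg z z').trans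
    (mul_le_mul_of_nonneg_right (Real.le_coe_toNNReal LC) (abs_nonneg _))).continuous.measurable

lemma abs_sub_half_le {b z : ℝ} (h : z ∈ Set.Icc 0 b) : |z - b / 2| ≤ b / 2 := by
  rw [abs_le]; constructor <;> linarith [h.1, h.2]

lemma integrable_comp_cost {α : Type*} [MeasurableSpace α] (μ : Measure α)
    [IsProbabilityMeasure μ] {g : ℝ → ℝ} {b : ℝ}
    (hg : ∀ z z', |g z - g z'| ≤ LC * |z - z'|) (hLC : 0 ≤ LC) {X : α → ℝ} (hX : Measurable X)
    (hmem : ∀ ω, X ω ∈ Set.Icc 0 b) :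
    Integrable (fun ω => g (X ω)) μ ∧ |∫ ω, g (X ω) ∂μ - g (b / 2)| ≤ LC * (b / 2) := by
  have h1 : ∀ ω, |g (X ω) - g (b / 2)| ≤ LC * (b / 2) := fun ω =>
    (hg _ _).trans (mul_le_mul_of_nonneg_left (abs_sub_half_le (hmem ω)) hLC)
  have h2 : Integrable (fun ω => g (X ω)) μ := by
    refine integrable_of_abs_le (K := |g (b / 2)| + LC * (b / 2))
      ((measurable_of_abs_sub_le hg).comp hX) fun ω => ?_
    have h3 := abs_add_le (g (X ω) - g (b / 2)) (g (b / 2))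
    rw [sub_add_cancel] at h3
    linarith [h1 ω]
  exact ⟨h2, RiskSOC.abs_integral_sub_le h2 h1⟩

instance (M : SOC dS dA Ξ) : Nonempty M.Policy :=
  ⟨M.feedback (fun _ _ => Classical.arbitrary _) fun _ => measurable_const⟩

/-- The expected terminal costs of a `[0, 1 / (1 - γ)]`-valued cost are bounded uniformly in the
parameter, the policy and the noise law. -/
lemma exists_abs_integral_sub_le (M : SOC dS dA Ξ) (hΘ : IsLipschitzRisk Θ f LC LΘ RΘ)
    (hne : Θ.Nonempty) (hLC : 0 ≤ LC) :
    ∃ m K : ℝ, ∀ (Q : Measure Ξ) [IsProbabilityMeasure Q] (X : M.S → (ℕ → M.A × Ξ) → ℝ),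
      (∀ s, Measurable (X s)) → (∀ s ω, X s ω ∈ Set.Icc 0 (1 / (1 - M.γ))) →
      ∀ (π : M.Policy) (s : M.S) (θ : Θ), |∫ ω, f θ (X s ω) ∂(M.law Q π s) - m| ≤ K := by
  obtain ⟨θ₀, h₀⟩ := hne
  obtain ⟨x, hx⟩ := hΘ.radius
  set b := 1 / (1 - M.γ)
  refine ⟨f θ₀ (b / 2), LC * (b / 2) + |LΘ| * (RΘ + RΘ), fun Q _ X hX hmem π s θ => ?_⟩
  have h1 := (integrable_comp_cost (M.law Q π s) (hΘ.lipschitz_cost θ θ.2) hLC (hX s)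
    (hmem s)).2
  have h2 := hΘ.lipschitz_param θ θ.2 θ₀ h₀ (b / 2)
  have h3 : ‖(θ : EuclideanSpace ℝ (Fin d)) - θ₀‖ ≤ RΘ + RΘ := by
    rw [← dist_eq_norm]
    exact (dist_triangle_right _ _ x).trans (add_le_add (hx θ.2) (hx h₀))
  have h4 : LΘ * ‖(θ : EuclideanSpace ℝ (Fin d)) - θ₀‖ ≤ |LΘ| * (RΘ + RΘ) :=
    (mul_le_mul_of_nonneg_right (le_abs_self _) (norm_nonneg _)).trans
      (mul_le_mul_of_nonneg_left h3 (abs_nonneg _))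
  have h5 := abs_sub_le (∫ ω, f θ (X s ω) ∂(M.law Q π s)) (f θ (b / 2)) (f θ₀ (b / 2))
  linarith

/-- Comparison of two optimal risks whose expected terminal costs are uniformly close. -/
lemma abs_iInf_risk_sub_le (hΘ : IsLipschitzRisk Θ f LC LΘ RΘ)
    (hne : Θ.Nonempty) (hLC : 0 ≤ LC) (Q Q' : Measure Ξ) [IsProbabilityMeasure Q]
    [IsProbabilityMeasure Q'] {X X' : M.S → (ℕ → M.A × Ξ) → ℝ} (hX : ∀ s, Measurable (X s))
    (hX' : ∀ s, Measurable (X' s)) (hmem : ∀ s ω, X s ω ∈ Set.Icc 0 (1 / (1 - M.γ)))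
    (hmem' : ∀ s ω, X' s ω ∈ Set.Icc 0 (1 / (1 - M.γ))) {s : M.S} {K : ℝ}
    (h : ∀ (π : M.Policy) (θ : Θ),
      |∫ ω, f θ (X s ω) ∂(M.law Q π s) - ∫ ω, f θ (X' s ω) ∂(M.law Q' π s)| ≤ K) :
    |(⨅ π : M.Policy, M.risk Θ f Q X π s) - ⨅ π : M.Policy, M.risk Θ f Q' X' π s| ≤ K := by
  have := hne.to_subtype
  obtain ⟨m, K', hK'⟩ := M.exists_abs_integral_sub_le hΘ hne hLC
  have hrisk : ∀ (Q : Measure Ξ) [IsProbabilityMeasure Q] {X : M.S → (ℕ → M.A × Ξ) → ℝ},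
      (∀ s, Measurable (X s)) → (∀ s ω, X s ω ∈ Set.Icc 0 (1 / (1 - M.γ))) →
      ∀ π : M.Policy, |M.risk Θ f Q X π s - m| ≤ K' := by
    intro Q _ X hX hmem π
    have := abs_ciInf_sub_ciInf_le (g' := fun _ : Θ => m)
      (bddBelow_range_of_abs_sub_le (hK' Q X hX hmem π s)) ⟨m, by simp⟩ (hK' Q X hX hmem π s)
    simpa [risk] using this
  exact abs_ciInf_sub_ciInf_le (bddBelow_range_of_abs_sub_le (hrisk Q hX hmem))
    (bddBelow_range_of_abs_sub_le (hrisk Q' hX' hmem')) fun π =>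
    abs_ciInf_sub_ciInf_le (bddBelow_range_of_abs_sub_le (hK' Q X hX hmem π s))
      (bddBelow_range_of_abs_sub_le (hK' Q' X' hX' hmem' π s)) (h π)

/-- Under every law and policy the expected terminal cost is within L_C/(2(1-γ)) of f_θ at the
midpoint of the cost range. This settles the case L_C < (1-γ)ε without samples. -/
lemma abs_optRiskTrunc_sub_optRisk_le_trivial (hΘ : IsLipschitzRisk Θ f LC LΘ RΘ)
    (hne : Θ.Nonempty) (hLC : 0 ≤ LC) (Q P : Measure Ξ) [IsProbabilityMeasure Q]
    [IsProbabilityMeasure P] (T : ℕ) (s : M.S) :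
    |M.optRiskTrunc Θ f Q T s - M.optRisk Θ f P s| ≤ LC / (1 - M.γ) := by
  refine abs_iInf_risk_sub_le hΘ hne hLC Q P (M.measurable_truncatedCost T)
    M.measurable_totalCost (M.truncatedCost_mem T) M.totalCost_mem fun π θ => ?_
  have h1 := (integrable_comp_cost (M.law Q π s) (hΘ.lipschitz_cost θ θ.2) hLC
    (M.measurable_truncatedCost T s) (M.truncatedCost_mem T s)).2
  have h2 := (integrable_comp_cost (M.law P π s) (hΘ.lipschitz_cost θ θ.2) hLC
    (M.measurable_totalCost s) (M.totalCost_mem s)).2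
  rw [abs_sub_comm] at h2
  refine (abs_sub_le _ _ _).trans ((add_le_add h1 h2).trans_eq ?_)
  ring

lemma abs_optRiskTrunc_sub_optRisk_le (hΘ : IsLipschitzRisk Θ f LC LΘ RΘ)
    (hne : Θ.Nonempty) (hLC : 0 ≤ LC) (P : Measure Ξ)
    [IsProbabilityMeasure P] (T : ℕ) (s : M.S) :
    |M.optRiskTrunc Θ f P T s - M.optRisk Θ f P s| ≤ LC * (M.γ ^ (T + 1) / (1 - M.γ)) := by
  refine abs_iInf_risk_sub_le hΘ hne hLC P P (M.measurable_truncatedCost T)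
    M.measurable_totalCost (M.truncatedCost_mem T) M.totalCost_mem fun π θ => ?_
  refine abs_integral_sub_integral_le
    (integrable_comp_cost (M.law P π s) (hΘ.lipschitz_cost θ θ.2) hLC
      (M.measurable_truncatedCost T s) (M.truncatedCost_mem T s)).1
    (integrable_comp_cost (M.law P π s) (hΘ.lipschitz_cost θ θ.2) hLC
      (M.measurable_totalCost s) (M.totalCost_mem s)).1 fun ω => ?_
  refine (hΘ.lipschitz_cost θ θ.2 _ _).trans (mul_le_mul_of_nonneg_left ?_ hLC)
  rw [abs_sub_comm]
  exact M.abs_totalCost_sub_le T s ω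

/-- One-step deviations between the laws `Q` and `P` of the value functions under `P`. -/
def DeviationLE (M : SOC dS dA Ξ) (P Q : Measure Ξ) (g : ℝ → ℝ) (T : ℕ) (e : ℝ) : Prop :=
  ∀ t < T + 1, ∀ (s : M.S) (a : M.A), ∀ z ∈ Set.Icc 0 (2 / (1 - M.γ)),
    |∫ ξ, M.value P g (T - t) (M.γ ^ (t + 1)) (M.F s a ξ) z ∂Q -
      ∫ ξ, M.value P g (T - t) (M.γ ^ (t + 1)) (M.F s a ξ) z ∂P| ≤ e

/-- A verification argument: the value functions of P are approximate sub- and supersolutions of the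
Bellman equation of Q, with defect e per stage. The slack η pays for the absence of exact measurable
minimizers. -/
lemma integral_near_value {P Q : Measure Ξ} [IsProbabilityMeasure P] [IsProbabilityMeasure Q]
    {g : ℝ → ℝ} (hg : ∀ z z', |g z - g z'| ≤ LC * |z - z'|) (hLC : 0 ≤ LC) (hℓ : 1 ≤ ℓ)
    (hM : M.IsLipschitz ℓ R) {T : ℕ} {e : ℝ} (hdev : M.DeviationLE P Q g T e) (s : M.S) :
    (∀ π : M.Policy, M.value P g (T + 1) 1 s 0 ≤
      ∫ ω, g (M.truncatedCost T s ω) ∂(M.law Q π s) + (T + 1) * e) ∧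
    ∀ η > 0, ∃ π : M.Policy, ∫ ω, g (M.truncatedCost T s ω) ∂(M.law Q π s) ≤
      M.value P g (T + 1) 1 s 0 + (T + 1) * (e + η) := by
  have hγ0 : ∀ t, 0 ≤ M.γ ^ t := pow_nonneg M.γ_nonneg
  have hγ1 : ∀ t, M.γ ^ t ≤ 1 := fun t => pow_le_one₀ M.γ_nonneg M.γ_lt_one.le
  have hb := M.one_sub_pos
  -- Stages 0 to T make T + 1 decisions, so T + 1 - t stages remain at time t and the current weight
  -- is γ^t.
  set V : ℕ → M.S → ℝ → ℝ := fun t => M.value P g (T + 1 - t) (M.γ ^ t) with hVdef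
  have hreg : ∀ t, IsRegular (V t) g LC _ _ := fun t =>
    isRegular_value (P := P) hg hLC hℓ hM (T + 1 - t) (hγ0 t) (hγ1 t)
  have hVm : ∀ t, Measurable fun p : M.S × ℝ => V t p.1 p.2 := fun t =>
    (hreg t).continuous.measurable
  obtain ⟨K, hK⟩ : ∃ K, ∀ t s, ∀ z ∈ Set.Icc 0 (1 / (1 - M.γ)), |V t s z| ≤ K := by
    refine ⟨LC / (1 - M.γ) + LC * (1 / (1 - M.γ)) + |g 0|, fun t s z hz => ?_⟩
    have h1 := (hreg t).bdd s z
    have h2 := hg z 0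
    rw [sub_zero, abs_of_nonneg hz.1] at h2
    have h3 := mul_le_mul_of_nonneg_left hz.2 hLC
    have h4 := abs_add_three (V t s z - g z) (g z - g 0) (g 0)
    rw [show V t s z - g z + (g z - g 0) + g 0 = V t s z by ring] at h4
    have h5 : LC * M.γ ^ t / (1 - M.γ) ≤ LC / (1 - M.γ) := by
      gcongr
      exact mul_le_of_le_one_right hLC (hγ1 t)
    linarith
  set J : ℕ → M.S × ℝ → M.A → ℝ := fun t x a =>
    ∫ ξ, V (t + 1) (M.F x.1 a ξ) (x.2 + M.γ ^ t * M.c x.1 a) ∂P with hJ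
  have hVJ : ∀ t < T + 1, ∀ s z, V t s z = ⨅ a, J t (s, z) a := by
    intro t ht s z
    have h1 : T + 1 - t = (T - t) + 1 := by omega
    have h2 : T + 1 - (t + 1) = T - t := by omega
    simp only [hVdef, hJ, h1, h2, value, ← pow_succ']
  have hJbdd : ∀ t x, BddBelow (Set.range (J t x)) := by
    intro t x
    have h := hreg (t + 1)
    rw [pow_succ'] at h
    exact bddBelow_range_of_abs_sub_le fun a =>
      h.abs_integral_sub_terminal_le hg hLC (hγ0 t) P x.1 a x.2
  have hJcont : ∀ t, Continuous fun p : (M.S × ℝ) × M.A => J t p.1 p.2 := by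
    intro t
    rw [continuous_iff_continuousAt]
    intro p
    rw [ContinuousAt, tendsto_iff_dist_tendsto_zero]
    have hκ : 0 ≤ LC * ((2 * ℓ) ^ (T + 1 - (t + 1)) - 1) :=
      mul_nonneg hLC (sub_nonneg.2 (one_le_pow₀ (by linarith)))
    refine squeeze_zero (fun _ => dist_nonneg) (fun q =>
      ((hreg (t + 1)).abs_integral_sub_le hLC hκ (by linarith) hM (hγ0 t) (hγ1 t) P q.1.1 p.1.1
        q.2 p.2 q.1.2 p.1.2 : dist (J t q.1 q.2) (J t p.1 p.2) ≤ _)) ?_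
    have : Continuous fun q : (M.S × ℝ) × M.A =>
        ℓ * (LC * ((2 * ℓ) ^ (T + 1 - (t + 1)) - 1) + LC) * (dist q.1.1 p.1.1 + dist q.2 p.2) +
          LC * |q.1.2 - p.1.2| := by fun_prop
    simpa using this.tendsto p
  -- The accumulated cost after stage t is at most 1/(1-γ) + 1 ≤ 2/(1-γ), which explains the range
  -- of z in `DeviationLE`.
  have hdev' : ∀ t < T + 1, ∀ s a, ∀ z ∈ Set.Icc 0 (1 / (1 - M.γ)),
      |∫ ξ, V (t + 1) (M.F s a ξ) (z + M.γ ^ t * M.c s a) ∂Q - J t (s, z) a| ≤ e := by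
    intro t ht s a z hz
    have hc := M.c_mem s a
    have h1 : (1 : ℝ) ≤ 1 / (1 - M.γ) := by
      rw [le_div_iff₀ hb]; linarith [M.γ_nonneg]
    have h2 : M.γ ^ t * M.c s a ≤ 1 := mul_le_one₀ (hγ1 t) hc.1 hc.2
    have h3 : (2 : ℝ) / (1 - M.γ) = 1 / (1 - M.γ) + 1 / (1 - M.γ) := by ring
    have := hdev t ht s a (z + M.γ ^ t * M.c s a)
      ⟨add_nonneg hz.1 (mul_nonneg (hγ0 t) hc.1), by linarith [hz.2]⟩
    simpa only [hJ, hVdef, show T + 1 - (t + 1) = T - t by omega] using this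
  have hend : ∀ π : M.Policy, ∫ ω, V (T + 1) (M.ctrl (T + 1) (s, fun i => ω i)).1
      (M.ctrl (T + 1) (s, fun i => ω i)).2 ∂(M.law Q π s) =
      ∫ ω, g (M.truncatedCost T s ω) ∂(M.law Q π s) := by
    intro π
    simp only [hVdef, Nat.sub_self, value, ctrl_succ_snd_eq]
  have hstart : V 0 s 0 = M.value P g (T + 1) 1 s 0 := by simp [hVdef]
  constructor
  · intro π
    have := M.le_integral_of_step Q π s hVm (e := e) (N := T + 1) hK fun t ht s a z hz => by
      rw [hVJ t ht]
      have h1 := ciInf_le (hJbdd t (s, z)) a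
      have h2 := (abs_le.1 (hdev' t ht s a z hz)).1
      linarith
    rw [hend, hstart] at this
    exact_mod_cast this
  · intro η hη
    have hsel : ∀ t, ∃ α : M.S × ℝ → M.A, Measurable α ∧ (t < T + 1 →
        ∀ x, J t x (α x) ≤ (⨅ a, J t x a) + η) := by
      intro t
      by_cases ht : t < T + 1
      · have hW : Measurable fun x => ⨅ a, J t x a := by
          have : (fun x => ⨅ a, J t x a) = fun x : M.S × ℝ => V t x.1 x.2 := by
            ext x; exact (hVJ t ht x.1 x.2).symm
          rw [this]; exact hVm t
        obtain ⟨α, hα, h⟩ := exists_measurable_approx_argmin (J := J t)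
          (fun a => ((hJcont t).comp (by fun_prop : Continuous fun x : M.S × ℝ => (x, a))).measurable)
          hW (fun x => (hJcont t).comp (by fun_prop : Continuous fun a : M.A => (x, a))) hη
        exact ⟨α, hα, fun _ => h⟩
      · exact ⟨fun _ => Classical.arbitrary _, measurable_const, fun h => absurd h ht⟩
    choose α hα hαJ using hsel
    refine ⟨M.feedback α hα, ?_⟩
    have := M.integral_feedback_le_of_step Q s hVm (e := e + η) (N := T + 1) hK α hα
      fun t ht s z hz => by
        rw [hVJ t ht]
        have h1 := hαJ t ht (s, z)
        have h2 := (abs_le.1 (hdev' t ht s (α t (s, z)) z hz)).2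
        linarith
    rw [hend, hstart] at this
    exact_mod_cast this

/-- The exchange of the two infima takes place here: the estimates for fixed θ hold for all
policies, respectively for a near-optimal one depending on θ. -/
lemma abs_optRiskTrunc_sub_iInf_value_le (hΘ : IsLipschitzRisk Θ f LC LΘ RΘ)
    (hne : Θ.Nonempty) (hLC : 0 ≤ LC) (hℓ : 1 ≤ ℓ) (hM : M.IsLipschitz ℓ R)
    {P Q : Measure Ξ} [IsProbabilityMeasure P] [IsProbabilityMeasure Q] {T : ℕ} {e : ℝ}
    (hdev : ∀ θ ∈ Θ, M.DeviationLE P Q (f θ) T e) (s : M.S) :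
    |M.optRiskTrunc Θ f Q T s - ⨅ θ : Θ, M.value P (f θ) (T + 1) 1 s 0| ≤ (T + 1) * e := by
  have := hne.to_subtype
  obtain ⟨m, K, hK⟩ := M.exists_abs_integral_sub_le hΘ hne hLC
  have hK := hK Q (M.truncatedCost T) (M.measurable_truncatedCost T) (M.truncatedCost_mem T)
  have hnear := fun θ : Θ =>
    integral_near_value (hΘ.lipschitz_cost θ θ.2) hLC hℓ hM (hdev θ θ.2) s
  have hrisk : ∀ π : M.Policy, m - K ≤ M.risk Θ f Q (M.truncatedCost T) π s := fun π =>
    le_ciInf fun θ => by linarith [(abs_le.1 (hK π s θ)).1]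
  have hval : BddBelow (Set.range fun θ : Θ => M.value P (f θ) (T + 1) 1 s 0) := by
    refine ⟨m - K - (T + 1) * (e + 1), ?_⟩
    rintro _ ⟨θ, rfl⟩
    obtain ⟨π, hπ⟩ := (hnear θ).2 1 one_pos
    have := (abs_le.1 (hK π s θ)).1
    dsimp only
    linarith
  rw [abs_le]
  constructor
  · have : (⨅ θ : Θ, M.value P (f θ) (T + 1) 1 s 0) - (T + 1) * e ≤ M.optRiskTrunc Θ f Q T s := by
      refine le_ciInf fun π => le_ciInf fun θ => ?_
      have h1 := ciInf_le hval θ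
      have h2 := (hnear θ).1 π
      linarith
    linarith
  · refine le_of_forall_pos_le_add fun η hη => ?_
    have hT : (0 : ℝ) < T + 1 := by positivity
    have : M.optRiskTrunc Θ f Q T s - (T + 1) * e - η ≤
        ⨅ θ : Θ, M.value P (f θ) (T + 1) 1 s 0 := by
      refine le_ciInf fun θ => ?_
      obtain ⟨π, hπ⟩ := (hnear θ).2 (η / (T + 1)) (by positivity)
      rw [mul_add, mul_div_cancel₀ _ hT.ne'] at hπ
      have h1 : M.optRiskTrunc Θ f Q T s ≤ M.risk Θ f Q (M.truncatedCost T) π s :=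
        ciInf_le ⟨m - K, by rintro _ ⟨π, rfl⟩; exact hrisk π⟩ π
      have h2 : M.risk Θ f Q (M.truncatedCost T) π s ≤
          ∫ ω, f θ (M.truncatedCost T s ω) ∂(M.law Q π s) :=
        ciInf_le (bddBelow_range_of_abs_sub_le (hK π s)) θ
      linarith
    linarith

/-- Deterministic part of the sample complexity bound. -/
lemma abs_optRiskTrunc_sub_optRisk_le_of_deviation (hΘ : IsLipschitzRisk Θ f LC LΘ RΘ)
    (hne : Θ.Nonempty) (hLC : 0 ≤ LC) (hℓ : 1 ≤ ℓ) (hM : M.IsLipschitz ℓ R)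
    {P Q : Measure Ξ} [IsProbabilityMeasure P] [IsProbabilityMeasure Q] {T : ℕ} {e : ℝ}
    (hdev : ∀ θ ∈ Θ, M.DeviationLE P Q (f θ) T e) (s : M.S) :
    |M.optRiskTrunc Θ f Q T s - M.optRisk Θ f P s| ≤
      (T + 1) * e + LC * (M.γ ^ (T + 1) / (1 - M.γ)) := by
  have h1 := abs_optRiskTrunc_sub_iInf_value_le hΘ hne hLC hℓ hM hdev s
  -- Taking Q = P and e = 0 shows that the infimum of the values over θ is exactly the optimal
  -- truncated risk under P.
  have h2 := abs_optRiskTrunc_sub_iInf_value_le (P := P) (Q := P) (e := 0) hΘ hne hLC hℓ hM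
    (T := T) (fun θ _ t _ s a z _ => by simp) s
  have h3 := abs_optRiskTrunc_sub_optRisk_le hΘ hne hLC P T s
  rw [mul_zero] at h2
  have h4 := sub_eq_zero.1 (abs_nonpos_iff.1 h2)
  rw [h4] at h3
  exact (abs_sub_le _ _ _).trans (add_le_add h1 h3)

end risk
end SOC


/-! ### Uniform concentration over a net. -/

/-- Union bound over a finite index set. -/
lemma measure_iUnion_le_card_mul {α ι : Type*} [MeasurableSpace α] (μ : Measure α) (s : Finset ι)
    {E : ι → Set α} {p : ℝ} (hp : 0 ≤ p) {N : ℝ} (hN : (s.card : ℝ) ≤ N)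
    (h : ∀ i ∈ s, μ (E i) ≤ ENNReal.ofReal p) : μ (⋃ i ∈ s, E i) ≤ ENNReal.ofReal (N * p) := by
  refine (measure_biUnion_finset_le s E).trans ((Finset.sum_le_sum h).trans ?_)
  rw [Finset.sum_const, nsmul_eq_mul, ← ENNReal.ofReal_natCast,
    ← ENNReal.ofReal_mul (Nat.cast_nonneg _)]
  exact ENNReal.ofReal_le_ofReal (mul_le_mul_of_nonneg_right hN hp)

namespace SOC
variable {M : SOC dS dA Ξ} {Θ : Set (EuclideanSpace ℝ (Fin d))}
  {f : EuclideanSpace ℝ (Fin d) → ℝ → ℝ} {LC LΘ RΘ ℓ R : ℝ}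

lemma abs_integral_value_sub_le (hΘ : IsLipschitzRisk Θ f LC LΘ RΘ) (hLC : 0 ≤ LC) (hℓ : 1 ≤ ℓ)
    (hM : M.IsLipschitz ℓ R) (P Q : Measure Ξ) [IsProbabilityMeasure P] [IsProbabilityMeasure Q]
    (m : ℕ) {w : ℝ} (hw : 0 ≤ w) (hw1 : w ≤ 1) (θ θ' : Θ) (s s' : M.S) (a a' : M.A) (z z' : ℝ) :
    |∫ ξ, M.value P (f θ) m w (M.F s a ξ) z ∂Q - ∫ ξ, M.value P (f θ') m w (M.F s' a' ξ) z' ∂Q| ≤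
      max 1 LΘ * dist θ θ' + (LC * (2 * ℓ) ^ (m + 1) * (dist s s' + dist a a') +
        LC * dist z z') := by
  have hreg := fun θ : Θ => isRegular_value (P := P) (hΘ.lipschitz_cost θ θ.2) hLC hℓ hM m hw hw1
  refine abs_integral_sub_integral_le ((hreg θ).integrable Q _ _ _)
    ((hreg θ').integrable Q _ _ _) fun ξ => ?_
  have h1 := abs_value_sub_value_le (P := P) (hΘ.lipschitz_cost θ θ.2)
    (hΘ.lipschitz_cost θ' θ'.2) hLC hℓ hM (K := max 1 LΘ * dist θ θ') (fun z => by
      refine (hΘ.lipschitz_param θ θ.2 θ' θ'.2 z).trans ?_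
      rw [Subtype.dist_eq, dist_eq_norm]
      exact mul_le_mul_of_nonneg_right (le_max_right _ _) (norm_nonneg _)) m hw hw1
      (M.F s a ξ) z
  have h2 := (hreg θ').lip (M.F s a ξ) (M.F s' a' ξ) z z'
  have h3 := hM.dist_transition_le (by linarith) s s' a a' ξ
  have hp : (1 : ℝ) ≤ (2 * ℓ) ^ m := one_le_pow₀ (by linarith)
  have h4 : LC * ((2 * ℓ) ^ m - 1) * dist (M.F s a ξ) (M.F s' a' ξ) ≤
      LC * (2 * ℓ) ^ (m + 1) * (dist s s' + dist a a') := by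
    calc _ ≤ LC * (2 * ℓ) ^ m * (2 * ℓ * (dist s s' + dist a a')) := by
          refine mul_le_mul ?_ (h3.trans ?_) dist_nonneg (by positivity)
          · exact mul_le_mul_of_nonneg_left (by linarith) hLC
          · exact mul_le_mul_of_nonneg_right (by linarith) (by positivity)
      _ = _ := by ring
  rw [← Real.dist_eq z z'] at h2
  exact (abs_sub_le _ _ _).trans (add_le_add h1 (h2.trans (by linarith)))

/-- Uniform concentration of the one-step expectations of the value functions. -/
lemma measure_not_deviationLE_le (hΘ : IsLipschitzRisk Θ f LC LΘ RΘ) (hLC : 0 < LC) (hℓ : 1 ≤ ℓ)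
    (hM : M.IsLipschitz ℓ R) (hR : 0 ≤ R) (hRΘ : 0 ≤ RΘ) (P : Measure Ξ)
    [IsProbabilityMeasure P] (n T : ℕ) [NeZero n] {rX rΘ rZ η : ℝ} (hrX : 0 < rX)
    (hrΘ : 0 < rΘ) (hrZ : 0 < rZ) (hη : 0 ≤ η) :
    Measure.pi (fun _ : Fin n => P) {x | ∃ θ ∈ Θ, ¬ M.DeviationLE P (empirical x) (f θ) T
      (η + 2 * (max 1 LΘ * rΘ + (LC * (2 * ℓ) ^ (T + 1) * (rX + rX) + LC * rZ)))} ≤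
    ENNReal.ofReal (((T + 1) * ((1 + 2 * RΘ / rΘ) ^ d * ((1 + 2 * R / rX) ^ dS *
      ((1 + 2 * R / rX) ^ dA * (1 + 2 * (1 / (1 - M.γ)) / rZ))))) *
        (2 * Real.exp (-(n * η ^ 2 / (2 * (LC / (1 - M.γ)) ^ 2))))) := by
  have hb := M.one_sub_pos
  obtain ⟨xS, hS⟩ := hM.radius_S
  obtain ⟨xA, hA⟩ := hM.radius_A
  obtain ⟨xΘ, hxΘ⟩ := hΘ.radius
  obtain ⟨NS, hNS, hNSc⟩ := exists_net hR hrX hS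
  obtain ⟨NA, hNA, hNAc⟩ := exists_net hR hrX hA
  obtain ⟨NΘ, hNΘ, hNΘc⟩ := exists_net hRΘ hrΘ hxΘ
  have hI : Set.Icc 0 (2 / (1 - M.γ)) ⊆ Metric.closedBall (1 / (1 - M.γ)) (1 / (1 - M.γ)) := by
    rw [Real.closedBall_eq_Icc]
    refine Set.Icc_subset_Icc (by simp) (le_of_eq (by ring))
  obtain ⟨NZ, hNZ, hNZc⟩ := exists_net (by positivity) hrZ hI
  rw [finrank_euclideanSpace_fin] at hNSc hNAc hNΘc
  rw [Module.finrank_self, pow_one] at hNZc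
  let net := Finset.range (T + 1) ×ˢ (NΘ ×ˢ (NS ×ˢ (NA ×ˢ NZ)))
  let g : ℕ × Θ × M.S × M.A × Set.Icc 0 (2 / (1 - M.γ)) → Ξ → ℝ := fun i ξ =>
    M.value P (f i.2.1) (T - i.1) (M.γ ^ (i.1 + 1)) (M.F i.2.2.1 i.2.2.2.1 ξ) i.2.2.2.2
  have hγ0 : ∀ t, 0 ≤ M.γ ^ t := pow_nonneg M.γ_nonneg
  have hγ1 : ∀ t, M.γ ^ t ≤ 1 := fun t => pow_le_one₀ M.γ_nonneg M.γ_lt_one.le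
  have hreg := fun (θ : Θ) (t : ℕ) => isRegular_value (P := P) (hΘ.lipschitz_cost θ θ.2)
    hLC.le hℓ hM (T - t) (hγ0 (t + 1)) (hγ1 (t + 1))
  have hcard : (net.card : ℝ) ≤ (T + 1) * ((1 + 2 * RΘ / rΘ) ^ d * ((1 + 2 * R / rX) ^ dS *
      ((1 + 2 * R / rX) ^ dA * (1 + 2 * (1 / (1 - M.γ)) / rZ)))) := by
    simp only [net, Finset.card_product, Finset.card_range]
    push_cast
    gcongr
  refine (measure_mono ?_).trans (measure_iUnion_le_card_mul _ net
    (E := fun i => {x | η < |∫ ξ, g i ξ ∂(empirical x) - ∫ ξ, g i ξ ∂P|})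
    (by positivity) hcard fun i _ => ?_)
  · rintro x ⟨θ, hθ, hx⟩
    contrapose! hx
    rw [Set.mem_iUnion₂] at hx
    push Not at hx
    intro t ht s a z hz
    obtain ⟨θ', hθ', dθ⟩ := hNΘ ⟨θ, hθ⟩
    obtain ⟨s', hs', ds⟩ := hNS s
    obtain ⟨a', ha', da⟩ := hNA a
    obtain ⟨z', hz', dz⟩ := hNZ ⟨z, hz⟩
    have h0 := hx (t, θ', s', a', z') (by
      simp only [net, Finset.mem_product, Finset.mem_range]
      exact ⟨ht, hθ', hs', ha', hz'⟩)
    rw [Set.mem_ofPred_eq, not_lt] at h0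
    -- Passing to the net point costs the same under the empirical law and under P, hence the factor
    -- 2 in the deviation bound.
    have hcl : ∀ (Q : Measure Ξ) [IsProbabilityMeasure Q],
        |∫ ξ, M.value P (f θ) (T - t) (M.γ ^ (t + 1)) (M.F s a ξ) z ∂Q -
          ∫ ξ, g (t, θ', s', a', z') ξ ∂Q| ≤
        max 1 LΘ * rΘ + (LC * (2 * ℓ) ^ (T + 1) * (rX + rX) + LC * rZ) := by
      intro Q _
      refine (abs_integral_value_sub_le hΘ hLC.le hℓ hM P Q (T - t) (hγ0 (t + 1)) (hγ1 (t + 1))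
        ⟨θ, hθ⟩ θ' s s' a a' z z').trans ?_
      have hp : (2 * ℓ) ^ (T - t + 1) ≤ (2 * ℓ) ^ (T + 1) :=
        pow_le_pow_right₀ (by linarith) (by omega)
      rw [Subtype.dist_eq] at dz
      have h1 : (1 : ℝ) ≤ max 1 LΘ := le_max_left _ _
      gcongr
    have h1 := abs_le.1 (hcl (empirical x))
    have h2 := abs_le.1 (hcl P)
    have h3 := abs_le.1 h0
    rw [abs_le]
    constructor <;> linarith [h1.1, h1.2, h2.1, h2.2, h3.1, h3.2]
  · refine measure_empirical_deviation_le P (m := f i.2.1 i.2.2.2.2) ?_ (by positivity) hη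
      fun ξ => ?_
    · exact (hreg i.2.1 i.1).continuous.measurable.comp
        ((M.measurable_F.comp (measurable_const.prodMk
          (measurable_const.prodMk measurable_id))).prodMk measurable_const)
    · refine ((hreg i.2.1 i.1).bdd _ _).trans ?_
      gcongr
      exact mul_le_of_le_one_right hLC.le (hγ1 _)

end SOC

/-! ### Numerical estimates for the sample size. -/

/-- The constant of the sample complexity bound, in terms of `lam = log κ` and `ρ = 1 - 1 / κ`. -/
def complexityConst (lam ρ : ℝ) : ℝ :=
  56 * ((1 + 5 / lam) * (1 + 2 * Real.log (1 + 32 * ((1 + 2 / lam) / ρ)))) *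
    ((1 + 2 / lam) / ρ) ^ 2 / lam ^ 2

lemma complexityConst_pos {lam ρ : ℝ} (hlam : 0 < lam) (hρ : 0 < ρ) :
    0 < complexityConst lam ρ := by
  have : 0 ≤ Real.log (1 + 32 * ((1 + 2 / lam) / ρ)) :=
    Real.log_nonneg (by have : 0 < 32 * ((1 + 2 / lam) / ρ) := by positivity
                        linarith)
  unfold complexityConst
  positivity

lemma add_add_add_two_le {a b c : ℕ} (ha : 1 ≤ a) (hb : 1 ≤ b) (hc : 1 ≤ c) :
    1 + (c + (a + (b + 1))) + 2 ≤ 7 * (a * b * c) := by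
  have h1 : a ≤ a * b * c := by
    rw [mul_assoc]; exact Nat.le_mul_of_pos_right _ (Nat.mul_pos hb hc)
  have h2 : b ≤ a * b * c := by
    rw [mul_comm a b, mul_assoc]; exact Nat.le_mul_of_pos_right _ (Nat.mul_pos ha hc)
  have h3 : c ≤ a * b * c := Nat.le_mul_of_pos_left _ (Nat.mul_pos ha hb)
  omega

/-- A union bound over `N ≤ U ^ k` events of probability `2 * exp (-E)`. -/
lemma card_mul_exp_le {U δ E N2 N3 N4 N5 : ℝ} {T : ℕ} {dS dA dΘ : ℕ} (hS : 1 ≤ dS)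
    (hA : 1 ≤ dA) (hΘ : 1 ≤ dΘ) (hδ : 0 < δ) (hU2 : 2 ≤ U) (hUδ : 1 / δ ≤ U)
    (hT : (T : ℝ) + 1 ≤ U) (h2 : 0 ≤ N2) (h3 : 0 ≤ N3) (h4 : 0 ≤ N4) (h5 : 0 ≤ N5) (h2' : N2 ≤ U)
    (h3' : N3 ≤ U) (h4' : N4 ≤ U) (h5' : N5 ≤ U)
    (hE : 7 * (dS * dA * dΘ : ℝ) * Real.log U ≤ E) :
    ((T + 1) * (N2 ^ dΘ * (N3 ^ dS * (N4 ^ dA * N5)))) * (2 * Real.exp (-E)) ≤ δ := by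
  have hU : 0 < U := by linarith
  have hN : ((T + 1 : ℝ) * (N2 ^ dΘ * (N3 ^ dS * (N4 ^ dA * N5)))) ≤
      U ^ (1 + (dΘ + (dS + (dA + 1)))) := by
    simp only [pow_add, pow_one]
    gcongr
  have h1 : U ^ (1 + (dΘ + (dS + (dA + 1)))) * 2 * (1 / δ) ≤ Real.exp E := by
    -- One extra factor U absorbs the 2 of the two-sided bound, another absorbs 1/δ.
    calc _ ≤ U ^ (1 + (dΘ + (dS + (dA + 1)))) * U * U := by gcongr
      _ = U ^ (1 + (dΘ + (dS + (dA + 1))) + 2) := by ring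
      _ ≤ U ^ (7 * (dS * dA * dΘ)) :=
        pow_le_pow_right₀ (by linarith) (add_add_add_two_le hS hA hΘ)
      _ = Real.exp (7 * (dS * dA * dΘ : ℝ) * Real.log U) := by
        rw [← Real.rpow_natCast, Real.rpow_def_of_pos hU]
        push_cast
        rw [mul_comm]
      _ ≤ _ := Real.exp_le_exp.2 hE
  rw [Real.exp_neg]
  calc _ ≤ U ^ (1 + (dΘ + (dS + (dA + 1)))) * (2 * (Real.exp E)⁻¹) := by gcongr
    _ = (U ^ (1 + (dΘ + (dS + (dA + 1)))) * 2 * (1 / δ)) * (Real.exp E)⁻¹ * δ := by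
      field_simp
    _ ≤ Real.exp E * (Real.exp E)⁻¹ * δ := by gcongr
    _ = δ := by rw [mul_inv_cancel₀ (Real.exp_pos E).ne', one_mul]

/-- The constant 56 is 7 · 2 · 4: the dimension count, the 2 in Hoeffding's exponent, and the
deviation level e/2. Of Λ⁵, one power comes from logU and two from 1/e²; the other two are traded
for lam². -/
lemma exponent_bound {lam k b Λ ε LC e D H k3 n logU : ℝ} (hlam : 0 < lam) (hk : 0 < k)
    (hb : 0 < b) (hΛ : lam ≤ Λ) (hε : 0 < ε) (hLC : 0 < LC) (he : 0 < e) (hD : 0 ≤ D)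
    (hH : 0 ≤ H) (hk3 : 0 ≤ k3) (hek : 1 / e ≤ k * (Λ / (b * ε)))
    (hn : 56 * k3 * k ^ 2 / lam ^ 2 * (LC ^ 2 * D * Λ ^ 5 / (b ^ 5 * ε ^ 2)) * H ≤ n)
    (hU : logU ≤ k3 * (Λ / b) * H) :
    7 * D * logU ≤ n * (e / 2) ^ 2 / (2 * (LC / b) ^ 2) := by
  have hΛ0 : 0 < Λ := hlam.trans_le hΛ
  have h1 : 1 ≤ k ^ 2 * (Λ / (b * ε)) ^ 2 * e ^ 2 := by
    have : 1 ≤ k * (Λ / (b * ε)) * e := by rwa [div_le_iff₀ he] at hek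
    calc (1 : ℝ) ≤ (k * (Λ / (b * ε)) * e) ^ 2 := one_le_pow₀ this
      _ = _ := by ring
  have h2 : 1 ≤ Λ ^ 2 / lam ^ 2 := by
    rw [one_le_div (by positivity)]
    gcongr
  calc 7 * D * logU ≤ 7 * D * (k3 * (Λ / b) * H) := by gcongr
    _ ≤ (7 * D * (k3 * (Λ / b) * H)) * (Λ ^ 2 / lam ^ 2) *
        (k ^ 2 * (Λ / (b * ε)) ^ 2 * e ^ 2) := by
      have h0 : 0 ≤ 7 * D * (k3 * (Λ / b) * H) := by positivity
      have h3 := le_mul_of_one_le_right h0 h2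
      exact h3.trans (le_mul_of_one_le_right (h0.trans h3) h1)
    _ = (56 * k3 * k ^ 2 / lam ^ 2 * (LC ^ 2 * D * Λ ^ 5 / (b ^ 5 * ε ^ 2)) * H) * (e / 2) ^ 2 /
        (2 * (LC / b) ^ 2) := by
      field_simp
      ring
    _ ≤ _ := by gcongr

/-- The dominant term is (T+1) log(2ℓ), linear in Λ/b. Lower-order terms are absorbed by Λ/b ≥ lam
and log G ≥ 1/2, and the constant g by H ≥ log 2 ≥ 1/2. -/
lemma log_le_of_decomposition {lam b Λ G g H ℓ : ℝ} {T : ℕ} (hlam : 0 < lam) (hb : 0 < b)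
    (hb1 : b ≤ 1) (hΛ : lam ≤ Λ) (hℓ : 1 ≤ ℓ) (hg : 1 ≤ g) (hT : (T : ℝ) ≤ Λ / b + 1)
    (hH : Real.log 2 ≤ H) (hG2 : 2 ≤ G) (hGH : Real.log G = Real.log g + H)
    (hℓG : 2 * ℓ ≤ G) :
    Real.log (G * (2 * ℓ) ^ (T + 1) / b) ≤
      ((1 + 5 / lam) * (1 + 2 * Real.log g)) * (Λ / b) * H := by
  have hl2 := Real.log_two_gt_d9
  have hG : 1 / 2 ≤ Real.log G := by
    have := Real.log_le_log (by norm_num) hG2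
    linarith
  have hq : lam ≤ Λ / b := hΛ.trans ((le_div_iff₀ hb).2
    (mul_le_of_le_one_right (hlam.le.trans hΛ) hb1))
  have h1 : Real.log (2 * ℓ) ≤ Real.log G := Real.log_le_log (by linarith) hℓG
  have h2 : -Real.log b ≤ 1 / b := by
    have := Real.log_le_sub_one_of_pos (inv_pos.2 hb)
    rw [Real.log_inv] at this
    rw [one_div]
    linarith
  have h3 : 1 / b ≤ Λ / b / lam := by
    rw [div_div, div_le_div_iff₀ hb (by positivity)]
    nlinarith
  have h4 : 1 ≤ Λ / b / lam := (one_le_div hlam).2 hq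
  have h5 : Real.log G ≤ (1 + 2 * Real.log g) * H := by
    have := Real.log_nonneg hg
    rw [hGH]
    nlinarith
  rw [Real.log_div (by positivity) hb.ne', Real.log_mul (by positivity) (by positivity),
    Real.log_pow]
  push_cast
  have h6 : (T + 1 : ℝ) * Real.log (2 * ℓ) ≤ (T + 1) * Real.log G := by gcongr
  calc _ ≤ Real.log G + (T + 1) * Real.log G + 1 / b := by linarith
    _ ≤ (Λ / b + 5 * (Λ / b / lam)) * Real.log G := by
      have h7 : 1 / b ≤ 2 * (Λ / b / lam) * Real.log G := by
        have : 0 < Λ / b / lam := by linarith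
        nlinarith
      have h8 : (1 + (T + 1 : ℝ)) * Real.log G ≤ (Λ / b + 3 * (Λ / b / lam)) * Real.log G :=
        mul_le_mul_of_nonneg_right (by linarith) (by linarith)
      linarith
    _ ≤ (Λ / b + 5 * (Λ / b / lam)) * ((1 + 2 * Real.log g) * H) := by
      have : 0 < Λ / b := by linarith
      gcongr
    _ = _ := by field_simp

/-- Numerical part of the sample complexity bound. -/
lemma failure_probability_le {κ b ε δ LC LΘ ℓ R RΘ Λ ρ X e : ℝ} {T n dS dA dΘ : ℕ} (hκ : 1 < κ)
    (hρ : ρ = 1 - 1 / κ) (hb : 0 < b) (hb1 : b ≤ 1) (hε : 0 < ε) (hδ : 0 < δ) (hδ1 : δ < 1)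
    (hLC : 0 < LC) (hLΘ : 1 ≤ LΘ) (hℓ : 1 ≤ ℓ) (hR : 0 ≤ R) (hRΘ : 0 ≤ RΘ) (hS : 1 ≤ dS)
    (hA : 1 ≤ dA) (hΘ : 1 ≤ dΘ) (hΛ : Real.log κ ≤ Λ) (hLΛ : b * ε ≤ LC)
    (hT : (T : ℝ) ≤ Λ / b + 1) (he : e = ρ * ε / (T + 1))
    (hX : X = max 1 LC * LΘ * ℓ * max 1 R * max 1 RΘ * Λ / (b * ε * δ))
    (hn : complexityConst (Real.log κ) ρ * (LC ^ 2 * dS * dA * dΘ * Λ ^ 5 / (b ^ 5 * ε ^ 2)) *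
      Real.log (2 + X) ≤ n) :
    ((T + 1) * ((1 + 2 * RΘ / (e / (16 * LΘ))) ^ dΘ *
      ((1 + 2 * R / (e / (16 * (LC * (2 * ℓ) ^ (T + 1))))) ^ dS *
      ((1 + 2 * R / (e / (16 * (LC * (2 * ℓ) ^ (T + 1))))) ^ dA *
        (1 + 2 * (1 / b) / (e / (16 * LC))))))) *
      (2 * Real.exp (-(n * (e / 2) ^ 2 / (2 * (LC / b) ^ 2)))) ≤ δ := by
  set lam := Real.log κ with hlamdef
  have hlam : 0 < lam := Real.log_pos hκ
  have hΛ0 : 0 < Λ := hlam.trans_le hΛ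
  have hρ0 : 0 < ρ := by
    rw [hρ, sub_pos, div_lt_one (by linarith)]; exact hκ
  have hρ1 : ρ ≤ 1 := by
    have : 0 < 1 / κ := by positivity
    linarith
  -- Chosen so that 1/e ≤ kΛ/(bε): T + 1 ≤ Λ/b + 2, and 2 ≤ (2/lam)(Λ/b) because b ≤ 1 and lam ≤ Λ.
  set k := (1 + 2 / lam) / ρ with hk
  have hk0 : 0 < k := by positivity
  have hklam : 1 / lam ≤ k / 2 := by
    rw [hk, div_div, le_div_iff₀ (by positivity)]
    have : 0 < 1 / lam := by positivity
    have h2 : 2 / lam = 2 * (1 / lam) := by ring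
    nlinarith
  have he0 : 0 < e := by rw [he]; positivity
  set p := Λ / (b * ε) with hp
  have hp0 : 0 < p := by positivity
  have hek : 1 / e ≤ k * p := by
    have hq : lam ≤ Λ / b := hΛ.trans ((le_div_iff₀ hb).2 (mul_le_of_le_one_right hΛ0.le hb1))
    have h1 : 1 ≤ Λ / b / lam := (one_le_div hlam).2 hq
    calc 1 / e = (T + 1) / (ρ * ε) := by rw [he]; field_simp
      _ ≤ (Λ / b + 2 * (Λ / b / lam)) / (ρ * ε) :=
        div_le_div_of_nonneg_right (by linarith) (by positivity)
      _ = k * p := by rw [hk, hp]; field_simp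
  set Y := max 1 LC * LΘ * ℓ * max 1 R * max 1 RΘ * p with hY
  have hXY : X * δ = Y := by rw [hX, hY, hp]; field_simp
  have hm1 : 1 ≤ max 1 LC := le_max_left _ _
  have hm2 : 1 ≤ max 1 R := le_max_left _ _
  have hm3 : 1 ≤ max 1 RΘ := le_max_left _ _
  have hm1' : LC ≤ max 1 LC := le_max_right _ _
  have hm2' : R ≤ max 1 R := le_max_right _ _
  have hm3' : RΘ ≤ max 1 RΘ := le_max_right _ _
  have hlamp : lam ≤ LC * p := by
    have h1 : 1 ≤ LC / (b * ε) := (one_le_div (by positivity)).2 hLΛ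
    have h2 : LC * p = Λ * (LC / (b * ε)) := by rw [hp]; ring
    rw [h2]
    exact hΛ.trans (le_mul_of_one_le_right hΛ0.le h1)
  have hYR : R * LC * p ≤ Y := by
    calc R * LC * p = LC * 1 * 1 * R * 1 * p := by ring
      _ ≤ Y := by rw [hY]; gcongr
  have hYΘ : RΘ * LΘ * p ≤ Y := by
    calc RΘ * LΘ * p = 1 * LΘ * 1 * 1 * RΘ * p := by ring
      _ ≤ Y := by rw [hY]; gcongr
  have hYℓ : ℓ * (LC * p) ≤ Y := by
    calc ℓ * (LC * p) = LC * 1 * ℓ * 1 * 1 * p := by ring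
      _ ≤ Y := by rw [hY]; gcongr
  have hYC : LC * p ≤ Y := (le_mul_of_one_le_left (by positivity) hℓ).trans hYℓ
  have hY0 : 0 < Y := by positivity
  have hX0 : 0 < X := by
    have := hXY ▸ hY0
    exact (pos_iff_pos_of_mul_pos this).2 hδ
  have hYX : Y ≤ X := by rw [← hXY]; exact mul_le_of_le_one_right hX0.le hδ1.le
  set G := (1 + 32 * k) * (2 + X) with hG
  have hkX : 0 < k * X := by positivity
  have hGexp : G = 2 + X + 64 * k + 32 * (k * X) := by rw [hG]; ring
  have hG2 : 2 ≤ G := by rw [hGexp]; linarith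
  have hG1 : 1 + 32 * k * Y ≤ G := by
    have : k * Y ≤ k * X := by gcongr
    rw [hGexp]; linarith
  have hℓG : 2 * ℓ ≤ G := by
    have h1 : ℓ * lam ≤ X := (mul_le_mul_of_nonneg_left hlamp (by linarith)).trans (hYℓ.trans hYX)
    have h2 : ℓ ≤ X * (1 / lam) := by rw [mul_one_div, le_div_iff₀ hlam]; exact h1
    have h3 : X * (1 / lam) ≤ X * (k / 2) := by gcongr
    rw [hGexp]; linarith
  set W := (2 * ℓ) ^ (T + 1) with hW
  have hW1 : 1 ≤ W := one_le_pow₀ (by linarith)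
  have hb' : 1 ≤ 1 / b := (one_le_div hb).2 hb1
  -- A common bound for 1/δ, T + 1 and every net factor: W covers the Lipschitz growth in the state
  -- and 1/b the length of the cost range.
  set U := G * W / b with hU
  have hUG : ∀ {x q : ℝ}, 1 ≤ q → q ≤ W * (1 / b) → x ≤ 32 * k * Y * q → 1 + x ≤ U := by
    intro x q hq hqW hx
    calc 1 + x ≤ (1 + 32 * k * Y) * q := by linarith
      _ ≤ G * (W * (1 / b)) := by gcongr
      _ = U := by rw [hU]; ring
  have hGU : G ≤ U := by
    calc G ≤ G * (W * (1 / b)) :=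
          le_mul_of_one_le_right (by linarith) (one_le_mul_of_one_le_of_one_le hW1 hb')
      _ = U := by rw [hU]; ring
  refine card_mul_exp_le hS hA hΘ hδ (hG2.trans hGU) ?_ ?_ (by positivity) (by positivity)
    (by positivity) (by positivity) ?_ ?_ ?_ ?_ ?_
  · have h1 : lam ≤ X * δ := by rw [hXY]; exact hlamp.trans hYC
    have h2 : 1 / δ ≤ X * (1 / lam) := by
      rw [mul_one_div, div_le_div_iff₀ hδ hlam]; linarith
    have h3 : X * (1 / lam) ≤ X * (k / 2) := by gcongr
    refine le_trans ?_ hGU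
    rw [hGexp]; linarith
  · have h1 : ((T + 1 : ℕ) : ℝ) ≤ 2 ^ (T + 1) := by exact_mod_cast (Nat.lt_two_pow_self).le
    push_cast at h1
    have h2 : (2 : ℝ) ^ (T + 1) ≤ W := by
      rw [hW]; gcongr; linarith
    calc (T : ℝ) + 1 ≤ 1 * W * 1 := by linarith
      _ ≤ G * W * (1 / b) := by gcongr; linarith
      _ = U := by rw [hU]; ring
  · refine hUG le_rfl (one_le_mul_of_one_le_of_one_le hW1 hb') ?_
    calc 2 * RΘ / (e / (16 * LΘ)) = 32 * (RΘ * LΘ) * (1 / e) := by field_simp; ring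
      _ ≤ 32 * (RΘ * LΘ) * (k * p) := by gcongr
      _ = 32 * k * (RΘ * LΘ * p) * 1 := by ring
      _ ≤ _ := by gcongr
  iterate 2
    · refine hUG hW1 (le_mul_of_one_le_right (by linarith) hb') ?_
      calc 2 * R / (e / (16 * (LC * W))) = 32 * (R * LC * W) * (1 / e) := by field_simp; ring
        _ ≤ 32 * (R * LC * W) * (k * p) := by gcongr
        _ = 32 * k * (R * LC * p) * W := by ring
        _ ≤ _ := by gcongr
  · refine hUG hb' (le_mul_of_one_le_left (by linarith) hW1) ?_
    calc 2 * (1 / b) / (e / (16 * LC)) = 32 * (LC * (1 / b)) * (1 / e) := by field_simp; ring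
      _ ≤ 32 * (LC * (1 / b)) * (k * p) := by gcongr
      _ = 32 * k * (LC * p) * (1 / b) := by ring
      _ ≤ _ := by gcongr
  · have hH : Real.log 2 ≤ Real.log (2 + X) := Real.log_le_log (by norm_num) (by linarith)
    have hg : 1 ≤ 1 + 32 * k := by linarith
    have hlog := log_le_of_decomposition hlam hb hb1 hΛ hℓ hg hT hH hG2
      (by rw [hG, Real.log_mul (by positivity) (by positivity)]) hℓG
    refine exponent_bound (k3 := (1 + 5 / lam) * (1 + 2 * Real.log (1 + 32 * k))) hlam hk0 hb hΛ
      hε hLC he0 (by positivity) ((Real.log_nonneg (by norm_num)).trans hH) ?_ hek ?_ hlog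
    · have := Real.log_nonneg hg
      positivity
    · refine le_trans (le_of_eq ?_) hn
      rw [complexityConst]
      ring

/-! ### Truncation error and choice of scales. -/

namespace SOC

/-- Since γ ≤ exp(-(1-γ)), a horizon T ≥ Λ/(1-γ) gives γ^T ≤ exp(-Λ), and Λ is the logarithm that
turns this into an error ε/κ. -/
lemma discount_pow_le (M : SOC dS dA Ξ) {κ LC ε Λ : ℝ} {T : ℕ} (hκ : 1 < κ) (hLC : 0 < LC)
    (hε : 0 < ε) (hΛ : Λ = Real.log (κ * LC / ((1 - M.γ) * ε))) (hT : Λ / (1 - M.γ) ≤ T) :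
    LC * (M.γ ^ (T + 1) / (1 - M.γ)) ≤ ε / κ := by
  have hb := M.one_sub_pos
  have h1 : M.γ ≤ Real.exp (-(1 - M.γ)) := by
    have := Real.add_one_le_exp (-(1 - M.γ))
    linarith
  have h2 : M.γ ^ (T + 1) ≤ (1 - M.γ) * ε / (κ * LC) := by
    calc M.γ ^ (T + 1) ≤ M.γ ^ T :=
          pow_le_pow_of_le_one M.γ_nonneg M.γ_lt_one.le (Nat.le_succ T)
      _ ≤ Real.exp (-(1 - M.γ)) ^ T := pow_le_pow_left₀ M.γ_nonneg h1 T
      _ = Real.exp (-(T * (1 - M.γ))) := by rw [← Real.exp_nat_mul]; ring_nf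
      _ ≤ Real.exp (-Λ) := Real.exp_le_exp.2 (neg_le_neg ((div_le_iff₀ hb).1 hT))
      _ = _ := by
        rw [hΛ, Real.exp_neg, Real.exp_log (by positivity), inv_div]
  calc _ ≤ LC * ((1 - M.γ) * ε / (κ * LC) / (1 - M.γ)) := by gcongr
    _ = ε / κ := by field_simp

end SOC

end RiskSOC

end

theorem mainTheorem9 (κ : ℝ) (hκ : 1 < κ) :
    ∃ C : ℝ, 0 < C ∧
      ∀ (dS dA dΘ : ℕ) (Ξ : Type u) [MeasurableSpace Ξ]
        (M : RiskSOC.SOC dS dA Ξ) (P : Measure Ξ) [IsProbabilityMeasure P]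
        (Θ : Set (EuclideanSpace ℝ (Fin dΘ))) (f : EuclideanSpace ℝ (Fin dΘ) → ℝ → ℝ)
        (LC LΘ RΘ L R ε δ : ℝ),
        1 ≤ dS → 1 ≤ dA → 1 ≤ dΘ → Θ.Nonempty → 0 < LC →
        RiskSOC.IsLipschitzRisk Θ f LC LΘ RΘ → M.IsLipschitz L R →
        0 < ε → 0 < δ → δ < 1 →
        ∀ (n : ℕ) [NeZero n],
          C * (LC ^ 2 * dS * dA * dΘ * Real.log (κ * LC / ((1 - M.γ) * ε)) ^ 5
              / ((1 - M.γ) ^ 5 * ε ^ 2))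
            * Real.log (2 + max 1 LC * max 1 LΘ * max 1 L * max 1 R * max 1 RΘ
                * Real.log (κ * LC / ((1 - M.γ) * ε)) / ((1 - M.γ) * ε * δ)) ≤ n →
          Measure.pi (fun _ : Fin n => P)
            {x | ∃ s : M.S,
              ε < |M.optRiskTrunc Θ f (RiskSOC.empirical x)
                    ⌈1 / (1 - M.γ) * Real.log (κ * LC / ((1 - M.γ) * ε))⌉₊ s
                  - M.optRisk Θ f P s|} ≤ ENNReal.ofReal δ := by
  have hκ0 : 0 < κ := by linarith
  have hρ : 0 < 1 - 1 / κ := by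
    rw [sub_pos, div_lt_one hκ0]; exact hκ
  refine ⟨RiskSOC.complexityConst (Real.log κ) (1 - 1 / κ),
    RiskSOC.complexityConst_pos (Real.log_pos hκ) hρ, ?_⟩
  intro dS dA dΘ Ξ _ M P _ Θ f LC LΘ RΘ L R ε δ hdS hdA hdΘ hne hLC hΘ hM hε hδ hδ1 n _ hn
  have hb := M.one_sub_pos
  have hb1 : 1 - M.γ ≤ 1 := by linarith [M.γ_nonneg]
  set Λ := Real.log (κ * LC / ((1 - M.γ) * ε)) with hΛdef
  set T := ⌈1 / (1 - M.γ) * Λ⌉₊ with hTdef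
  -- For L_C < (1-γ)ε, Λ may be small or negative, but the trivial bound makes the bad event empty.
  -- Otherwise Λ ≥ log κ > 0.
  rcases lt_or_ge LC ((1 - M.γ) * ε) with hsmall | hlarge
  · have hempty : {x : Fin n → Ξ | ∃ s : M.S, ε <
        |M.optRiskTrunc Θ f (RiskSOC.empirical x) T s - M.optRisk Θ f P s|} = ∅ := by
      refine Set.eq_empty_of_forall_notMem fun x hx => ?_
      obtain ⟨s, hs⟩ := hx
      have h1 := RiskSOC.SOC.abs_optRiskTrunc_sub_optRisk_le_trivial (M := M) hΘ hne hLC.le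
        (RiskSOC.empirical x) P T s
      have h2 : LC / (1 - M.γ) < ε := by rw [div_lt_iff₀ hb]; linarith
      linarith
    rw [hempty, measure_empty]
    exact zero_le
  · have hΛ : Real.log κ ≤ Λ := by
      refine Real.log_le_log hκ0 ?_
      rw [mul_div_assoc]
      exact le_mul_of_one_le_right hκ0.le ((one_le_div (by positivity)).2 hlarge)
    have hΛ0 : 0 < Λ := (Real.log_pos hκ).trans_le hΛ
    have hTle : Λ / (1 - M.γ) ≤ T := by
      rw [div_eq_mul_one_div, mul_comm]; exact Nat.le_ceil _
    have hTge : (T : ℝ) ≤ Λ / (1 - M.γ) + 1 := by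
      rw [div_eq_mul_one_div Λ, mul_comm Λ]
      exact (Nat.ceil_lt_add_one (by positivity)).le
    obtain ⟨xA, hxA⟩ := hM.radius_A
    obtain ⟨xΘ, hxΘ⟩ := hΘ.radius
    have hR : 0 ≤ R := by
      obtain ⟨a, ha⟩ := M.nonempty_A
      exact dist_nonneg.trans (Metric.mem_closedBall.1 (hxA ha))
    have hRΘ : 0 ≤ RΘ := by
      obtain ⟨θ, hθ⟩ := hne
      exact dist_nonneg.trans (Metric.mem_closedBall.1 (hxΘ hθ))
    have hM' := hM.mono (le_max_right 1 L)
    have hℓ : 1 ≤ max 1 L := le_max_left _ _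
    have hLΘ : 1 ≤ max 1 LΘ := le_max_left _ _
    -- The T + 1 stages together may use ε - ε/κ; the remaining ε/κ is for truncation.
    set e := (1 - 1 / κ) * ε / (T + 1) with he
    have he0 : 0 < e := by positivity
    set W := LC * (2 * max 1 L) ^ (T + 1) with hW
    have hW0 : 0 < W := by positivity
    have hmeas := RiskSOC.SOC.measure_not_deviationLE_le hΘ hLC hℓ hM' hR hRΘ P n T
      (rX := e / (16 * W)) (rΘ := e / (16 * max 1 LΘ)) (rZ := e / (16 * LC)) (η := e / 2)
      (by positivity) (by positivity) (by positivity) (by positivity)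
    -- The parameter, state, action and cost nets each contribute e/16. Doubled, they sum to e/2;
    -- the other e/2 is the Hoeffding deviation.
    have hrad : e / 2 + 2 * (max 1 LΘ * (e / (16 * max 1 LΘ)) +
        (LC * (2 * max 1 L) ^ (T + 1) * (e / (16 * W) + e / (16 * W)) +
          LC * (e / (16 * LC)))) = e := by
      rw [← hW]
      field_simp
      ring
    rw [hrad] at hmeas
    refine (measure_mono ?_).trans (hmeas.trans (ENNReal.ofReal_le_ofReal ?_))
    · rintro x ⟨s, hs⟩
      change ∃ θ ∈ Θ, ¬ M.DeviationLE P (RiskSOC.empirical x) (f θ) T e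
      by_contra! hdev
      have h1 := RiskSOC.SOC.abs_optRiskTrunc_sub_optRisk_le_of_deviation hΘ hne hLC.le hℓ hM'
        hdev s
      have h2 := M.discount_pow_le hκ hLC hε hΛdef hTle
      have h3 : (T + 1) * e = ε - ε / κ := by
        rw [he]; field_simp
      linarith
    · exact RiskSOC.failure_probability_le hκ rfl hb hb1 hε hδ hδ1 hLC hLΘ hℓ hR hRΘ hdS hdA
        hdΘ hΛ hlarge hTge he rfl hn
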